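/- Let $M$ be a $\mathrm{II}_1$ factor with separable predual and faithful normal tracial state $\tau$, acting on $L^2(M)=L^2(M,\tau)$ by left multiplication, and let $A\subset M$ be a masa (maximal abelian self-adjoint subalgebra), with $\tau$-preserving normal conditional expectation $\mathbb E_A\colon M\to A$. Let $X$ be a compact metrizable space with $C(X)$ embedded as a unital, weak-operator dense $C^*$-subalgebra of $A$, and let $\lambda$ be the Borel probability measure on $X$ with $\int_X f\,d\lambda=\tau(f)$ for $f\in C(X)$, so that $A\cong L^\infty(X,\lambda)$. Write $L^2(M)\cong\int^\oplus_{X\times X}\mathcal H_{t,s}\,d\eta(t,s)$, where $\eta$ is a finite Borel measure and the $\mathcal H_{t,s}$ are nonzero, so that $\zeta\mapsto a\zeta b$ becomes multiplication by $a(t)b(s)$ for $a,b\in C(X)$. The measure class of $\eta|_{\Delta(X)^c}$, where $\Delta(X)$ is the diagonal of $X\times X$, is called the left--right measure of $A$. Suppose that the left--right measure of $A$ is the class of the product measure $\lambda\otimes\lambda$. Let $x,y\in M$ satisfy $\mathbb E_A(x)=0=\mathbb E_A(y)$. If $(u_n)$ is a bounded sequence in $A$ converging to $0$ in the weak operator topology,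 then the functions $\mathbb E_A(xu_ny^*)\in A\cong L^\infty(X,\lambda)$ converge to $0$ $\lambda$-almost everywhere. -/

import Mathlib

open MeasureTheory Filter Topology
open scoped ENNReal InnerProductSpace ComplexOrder

/-- `M` is a II₁ factor in standard form, with trace vector `Ω`: the vector state
`τ x = ⟪Ω, x Ω⟫` is a faithful (automatically normal) tracial state on the infinite-dimensional
factor `M`, and `Ω` is cyclic. Thus `x ↦ x Ω` identifies the completion `L²(M, τ)` of `M` with `H`,
and `M` acts on it by left multiplication. -/
structure IsIIOneStandardForm {H : Type*} [NormedAddCommGroup H] [InnerProductSpace ℂ H]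
    [CompleteSpace H] (M : VonNeumannAlgebra H) (Ω : H) : Prop where
  norm_eq_one : ‖Ω‖ = 1
  trace_comm : ∀ x ∈ M, ∀ y ∈ M, ⟪Ω, (x * y) Ω⟫_ℂ = ⟪Ω, (y * x) Ω⟫_ℂ
  faithful : ∀ x ∈ M, ⟪Ω, (star x * x) Ω⟫_ℂ = 0 → x = 0
  cyclic : Dense {v : H | ∃ x ∈ M, x Ω = v}
  factor : ∀ z ∈ M, (∀ x ∈ M, z * x = x * z) → ∃ c : ℂ, z = c • (1 : H →L[ℂ] H)
  infinite : ¬ FiniteDimensional ℂ M.toStarSubalgebra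

/-- `A` is a maximal abelian self-adjoint subalgebra of `M`. -/
structure IsMasa {H : Type*} [NormedAddCommGroup H] [InnerProductSpace ℂ H]
    [CompleteSpace H] (A M : VonNeumannAlgebra H) : Prop where
  le : A ≤ M
  comm : ∀ a ∈ A, ∀ b ∈ A, a * b = b * a
  maximal : ∀ B : StarSubalgebra ℂ (H →L[ℂ] H), (∀ b ∈ B, b ∈ M) →
    (∀ a ∈ B, ∀ b ∈ B, a * b = b * a) → (∀ a ∈ A, a ∈ B) → ∀ b ∈ B, b ∈ A

/-- `L²(A)`, the closure of `A Ω` in `L²(M) = H`. -/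
noncomputable def masaL2 {H : Type*} [NormedAddCommGroup H] [InnerProductSpace ℂ H]
    [CompleteSpace H] (A : VonNeumannAlgebra H) (Ω : H) : Submodule ℂ H :=
  (A.toStarSubalgebra.toSubalgebra.toSubmodule.map
    (ContinuousLinearMap.apply ℂ H Ω).toLinearMap).topologicalClosure

instance {H : Type*} [NormedAddCommGroup H] [InnerProductSpace ℂ H]
    [CompleteSpace H] (A : VonNeumannAlgebra H) (Ω : H) :
    (masaL2 A Ω).HasOrthogonalProjection := by
  have : CompleteSpace (masaL2 A Ω) :=
    (Submodule.isClosed_topologicalClosure _).completeSpace_coe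
  infer_instance

/-- The Jones projection `e_A : L²(M) → L²(A)`. -/
noncomputable def jonesProj {H : Type*} [NormedAddCommGroup H] [InnerProductSpace ℂ H]
    [CompleteSpace H] (A : VonNeumannAlgebra H) (Ω : H) : H →L[ℂ] H :=
  (masaL2 A Ω).starProjection

section
variable {H : Type*} [NormedAddCommGroup H] [InnerProductSpace ℂ H]
    [CompleteSpace H] {A M : VonNeumannAlgebra H} {Ω : H}

theorem masaL2_induction {p : H → Prop} (hp : IsClosed {v | p v})
    (h : ∀ a ∈ A, p (a Ω)) {v : H} (hv : v ∈ masaL2 A Ω) : p v := by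
  have : (masaL2 A Ω : Set H) ⊆ {v | p v} := by
    refine closure_minimal ?_ hp
    rintro _ ⟨a, ha, rfl⟩
    exact h a ha
  exact this hv

theorem apply_mem_masaL2 {a : H →L[ℂ] H} (ha : a ∈ A) : a Ω ∈ masaL2 A Ω :=
  subset_closure ⟨a, ha, rfl⟩

theorem jonesProj_mem (v : H) : jonesProj A Ω v ∈ masaL2 A Ω :=
  Submodule.starProjection_apply_mem _ _

theorem jonesProj_of_mem {v : H} (hv : v ∈ masaL2 A Ω) : jonesProj A Ω v = v :=
  Submodule.starProjection_eq_self_iff.2 hv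

theorem jonesProj_inner (v w : H) : ⟪jonesProj A Ω v, w⟫_ℂ = ⟪v, jonesProj A Ω w⟫_ℂ :=
  Submodule.inner_starProjection_left_eq_right _ _ _

theorem jonesProj_eq_zero {v : H} (h : ∀ c ∈ A, ⟪c Ω, v⟫_ℂ = 0) : jonesProj A Ω v = 0 := by
  have h2 : ∀ w ∈ masaL2 A Ω, ⟪w, v⟫_ℂ = 0 := fun w hw =>
    masaL2_induction (p := fun w => ⟪w, v⟫_ℂ = 0)
      (isClosed_eq (by fun_prop) continuous_const) h hw
  refine Submodule.eq_starProjection_of_mem_of_inner_eq_zero (zero_mem _) fun w hw => ?_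
  rw [sub_zero, ← inner_conj_symm, h2 w hw, map_zero]

theorem eq_of_mem_masaL2 {v w : H} (hv : v ∈ masaL2 A Ω) (hw : w ∈ masaL2 A Ω)
    (h : ∀ c ∈ A, ⟪c Ω, v⟫_ℂ = ⟪c Ω, w⟫_ℂ) : v = w := by
  have := jonesProj_eq_zero (A := A) (Ω := Ω) (v := v - w)
    (fun c hc => by rw [inner_sub_right, h c hc, sub_self])
  rw [jonesProj_of_mem (sub_mem hv hw)] at this
  exact sub_eq_zero.1 this

theorem masaL2_map {a : H →L[ℂ] H} (ha : a ∈ A) {v : H} (hv : v ∈ masaL2 A Ω) :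
    a v ∈ masaL2 A Ω :=
  masaL2_induction (p := fun v => a v ∈ masaL2 A Ω)
    ((Submodule.isClosed_topologicalClosure _).preimage a.continuous)
    (fun b hb => apply_mem_masaL2 (a := a * b) (mul_mem ha hb)) hv

theorem inner_star (a : H →L[ℂ] H) (v w : H) : ⟪v, star a w⟫_ℂ = ⟪a v, w⟫_ℂ :=
  ContinuousLinearMap.adjoint_inner_right a v w

theorem inner_star' (a : H →L[ℂ] H) (v w : H) : ⟪star a v, w⟫_ℂ = ⟪v, a w⟫_ℂ :=
  ContinuousLinearMap.adjoint_inner_left a w v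

theorem jonesProj_comm {a : H →L[ℂ] H} (ha : a ∈ A) (v : H) :
    jonesProj A Ω (a v) = a (jonesProj A Ω v) := by
  refine eq_of_mem_masaL2 (jonesProj_mem _) (masaL2_map ha (jonesProj_mem _)) fun c hc => ?_
  rw [← jonesProj_inner, jonesProj_of_mem (apply_mem_masaL2 hc), ← inner_star',
    ← inner_star' a, ← jonesProj_inner,
    jonesProj_of_mem (masaL2_map (star_mem ha) (apply_mem_masaL2 hc))]

theorem apply_ext_of_cut {S T : H →L[ℂ] H} (hS : ∀ v, S (jonesProj A Ω v) = S v)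
    (hT : ∀ v, T (jonesProj A Ω v) = T v) (h : ∀ b ∈ A, S (b Ω) = T (b Ω)) : S = T := by
  ext v
  rw [← hS, ← hT]
  exact masaL2_induction (p := fun v => S v = T v)
    (isClosed_eq S.continuous T.continuous) h (jonesProj_mem v)

/-- Operators on `L²(A)` commuting with `A` commute with each other. -/
theorem cut_commute (hA : IsMasa A M) {S T : H →L[ℂ] H}
    (hSc : ∀ a ∈ A, ∀ v, S (a v) = a (S v)) (hTc : ∀ a ∈ A, ∀ v, T (a v) = a (T v))
    (hS : ∀ v, S (jonesProj A Ω v) = S v) (hT : ∀ v, T (jonesProj A Ω v) = T v)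
    (hS' : ∀ v, jonesProj A Ω (S v) = S v) (hT' : ∀ v, jonesProj A Ω (T v) = T v) :
    S * T = T * S := by
  have hSm : ∀ v, S v ∈ masaL2 A Ω := fun v => hS' v ▸ jonesProj_mem _
  have hTm : ∀ v, T v ∈ masaL2 A Ω := fun v => hT' v ▸ jonesProj_mem _
  have hSstar : star S Ω ∈ masaL2 A Ω := by
    have : jonesProj A Ω (star S Ω) = star S Ω := by
      refine ext_inner_left ℂ fun v => ?_
      rw [← jonesProj_inner, inner_star, inner_star, hS]
    exact this ▸ jonesProj_mem _
  have hnorm : ∀ a ∈ A, ‖star a Ω‖ = ‖a Ω‖ := by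
    intro a ha
    have : ⟪star a Ω, star a Ω⟫_ℂ = ⟪a Ω, a Ω⟫_ℂ := by
      rw [inner_star', ← inner_star]
      have := congrArg (fun t : H →L[ℂ] H => t Ω) (hA.comm a ha (star a) (star_mem ha))
      exact congrArg _ this
    rw [inner_self_eq_norm_sq_to_K, inner_self_eq_norm_sq_to_K] at this
    have h2 : ‖star a Ω‖ ^ 2 = ‖a Ω‖ ^ 2 := by exact_mod_cast this
    exact (sq_eq_sq₀ (norm_nonneg _) (norm_nonneg _)).1 h2
  obtain ⟨s, hs, hslim⟩ := mem_closure_iff_seq_limit.1 (show S Ω ∈ closure _ from hSm Ω)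
  choose a ha has using hs
  have has' : ∀ n, a n Ω = s n := has
  replace ha : ∀ n, a n ∈ A := ha
  have hlim : Tendsto (fun n => a n Ω) atTop (𝓝 (S Ω)) := by simpa only [has'] using hslim
  have hc : CauchySeq (fun n => star (a n) Ω) := by
    have h1 := hlim.cauchySeq
    rw [Metric.cauchySeq_iff] at h1 ⊢
    intro ε hε
    obtain ⟨N, hN⟩ := h1 ε hε
    refine ⟨N, fun m hm n hn => ?_⟩
    have := hN m hm n hn
    rw [dist_eq_norm] at this ⊢
    have h2 := hnorm (a m - a n) (sub_mem (ha m) (ha n))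
    rw [star_sub] at h2
    simp only [sub_apply] at h2
    rwa [h2]
  obtain ⟨η, hη⟩ := cauchySeq_tendsto_of_complete hc
  have hηeq : η = star S Ω := by
    refine eq_of_mem_masaL2 (A := A) (Ω := Ω) ?_ hSstar fun c hc => ?_
    · exact (Submodule.isClosed_topologicalClosure _).mem_of_tendsto hη
        (Eventually.of_forall fun n => apply_mem_masaL2 (star_mem (ha n)))
    · have h1 : Tendsto (fun n => ⟪c Ω, star (a n) Ω⟫_ℂ) atTop (𝓝 ⟪c Ω, η⟫_ℂ) :=
        Filter.Tendsto.inner tendsto_const_nhds hη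
      have h2 : Tendsto (fun n => ⟪c (a n Ω), Ω⟫_ℂ) atTop (𝓝 ⟪c (S Ω), Ω⟫_ℂ) :=
        Filter.Tendsto.inner ((c.continuous.tendsto _).comp hlim) tendsto_const_nhds
      have h3 : (fun n => ⟪c Ω, star (a n) Ω⟫_ℂ) = fun n => ⟪c (a n Ω), Ω⟫_ℂ := by
        funext n
        rw [inner_star]
        exact congrArg (fun t : H →L[ℂ] H => ⟪t Ω, Ω⟫_ℂ) (hA.comm _ (ha n) _ hc)
      rw [h3] at h1
      rw [tendsto_nhds_unique h1 h2, inner_star, hSc c hc]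
  have key : ∀ d ∈ A, ⟪Ω, S (T (d Ω))⟫_ℂ = ⟪Ω, T (S (d Ω))⟫_ℂ := by
    intro d hd
    have h1 : Tendsto (fun n => ⟪star (a n) Ω, T (d Ω)⟫_ℂ) atTop (𝓝 ⟪η, T (d Ω)⟫_ℂ) :=
      Filter.Tendsto.inner hη tendsto_const_nhds
    have h2 : Tendsto (fun n => ⟪Ω, T (d (a n Ω))⟫_ℂ) atTop (𝓝 ⟪Ω, T (d (S Ω))⟫_ℂ) :=
      Filter.Tendsto.inner tendsto_const_nhds
        (((T.continuous.comp d.continuous).tendsto _).comp hlim)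
    have h3 : (fun n => ⟪star (a n) Ω, T (d Ω)⟫_ℂ) = fun n => ⟪Ω, T (d (a n Ω))⟫_ℂ := by
      funext n
      rw [inner_star', ← hTc _ (ha n)]
      exact congrArg (fun t : H →L[ℂ] H => ⟪Ω, T (t Ω)⟫_ℂ) (hA.comm _ (ha n) _ hd)
    rw [h3] at h1
    have h4 := tendsto_nhds_unique h1 h2
    rw [hηeq, inner_star'] at h4
    rw [h4, ← hSc d hd]
  refine apply_ext_of_cut (A := A) (Ω := Ω) (fun v => ?_) (fun v => ?_) fun b hb => ?_
  · change S (T (jonesProj A Ω v)) = S (T v)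
    rw [hT]
  · change T (S (jonesProj A Ω v)) = T (S v)
    rw [hS]
  · refine eq_of_mem_masaL2 (A := A) (Ω := Ω) (hSm _) (hTm _) fun c hc => ?_
    change ⟪c Ω, S (T (b Ω))⟫_ℂ = ⟪c Ω, T (S (b Ω))⟫_ℂ
    rw [← inner_star, ← inner_star c, ← hSc _ (star_mem hc), ← hTc _ (star_mem hc),
      ← hTc _ (star_mem hc), ← hSc _ (star_mem hc)]
    exact key _ (mul_mem (star_mem hc) hb)

/-- The Jones projection maps `M` into `A`. -/
theorem exists_masaCondExp (hM : IsIIOneStandardForm M Ω) (hA : IsMasa A M) {z : H →L[ℂ] H}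
    (hz : z ∈ M) : ∃ a ∈ A, a Ω = jonesProj A Ω (z Ω) := by
  set e := jonesProj A Ω with he
  have hee : ∀ v, e (e v) = e v := fun v => jonesProj_of_mem (jonesProj_mem _)
  have hΩ : e Ω = Ω := jonesProj_of_mem (apply_mem_masaL2 (a := 1) (one_mem A))
  have cutcomm : ∀ s : H →L[ℂ] H, (∀ a ∈ A, ∀ w ∈ masaL2 A Ω, e (s (a w)) = e (a (s w))) →
      ∀ a ∈ A, ∀ v, (e * s * e) (a v) = a ((e * s * e) v) := by
    intro s hs a ha v
    change e (s (e (a v))) = a (e (s (e v)))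
    rw [he, jonesProj_comm ha, ← he, hs a ha _ (jonesProj_mem _), he, jonesProj_comm ha]
  set T := e * z * e with hTdef
  have hTc : ∀ a ∈ A, ∀ v, T (a v) = a (T v) := by
    refine cutcomm z fun a ha w hw => ?_
    refine masaL2_induction (p := fun w => e (z (a w)) = e (a (z w)))
      (isClosed_eq (by fun_prop) (by fun_prop)) (fun b hb => ?_) hw
    rw [← sub_eq_zero, ← map_sub]
    refine jonesProj_eq_zero fun c hc => ?_
    have haM := hA.le ha
    have hbM := hA.le hb
    have hcM := hA.le (star_mem hc : star c ∈ A)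
    rw [inner_sub_right, sub_eq_zero]
    have e0 : ∀ w : H, ⟪c Ω, w⟫_ℂ = ⟪Ω, star c w⟫_ℂ := fun w => (inner_star c Ω w).symm
    rw [e0, e0]
    have e1 := hM.trace_comm (star c * z) (mul_mem hcM hz) (a * b) (mul_mem haM hbM)
    have e2 := hM.trace_comm (star c * a * z) (mul_mem (mul_mem hcM haM) hz) b hbM
    have e3 : a * b * (star c * z) = b * (star c * a * z) := by
      rw [← mul_assoc, hA.comm a ha b hb, mul_assoc b a,
        hA.comm a ha _ (star_mem hc)]
      simp only [mul_assoc]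
    rw [e3, ← e2] at e1
    simpa using e1
  have hTcut : ∀ v, T (e v) = T v := fun v => by
    change e (z (e (e v))) = e (z (e v)); rw [hee]
  have hTcut' : ∀ v, e (T v) = T v := fun v => hee _
  have hTΩ : T Ω = e (z Ω) := by change e (z (e Ω)) = _; rw [hΩ]
  set ξ := e (z Ω)
  -- commutant of `A`
  let N := A.commutant
  let ev : N.toStarSubalgebra.toSubalgebra.toSubmodule →ₗ[ℂ] H :=
    (ContinuousLinearMap.apply ℂ H Ω).toLinearMap.comp (Submodule.subtype _)
  let fx : N.toStarSubalgebra.toSubalgebra.toSubmodule →ₗ[ℂ] H :=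
    (ContinuousLinearMap.apply ℂ H ξ).toLinearMap.comp (Submodule.subtype _)
  have hev : ∀ m, ev m = m.1 Ω := fun _ => rfl
  have hfx : ∀ m, fx m = m.1 ξ := fun _ => rfl
  have hN : ∀ m ∈ N, ∀ a ∈ A, ∀ v, m (a v) = a (m v) := by
    intro m hm a ha v
    have := VonNeumannAlgebra.mem_commutant_iff.1 hm a ha
    exact (congrArg (fun t : H →L[ℂ] H => t v) this).symm
  have hbound : ∀ m, ‖fx m‖ ≤ ‖T‖ * ‖ev m‖ := by
    rintro ⟨m, hm⟩
    replace hm : m ∈ N := hm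
    rw [hfx, hev]
    change ‖m ξ‖ ≤ ‖T‖ * ‖m Ω‖
    have hs : star m * m ∈ N := mul_mem (star_mem hm) hm
    set S := e * (star m * m) * e with hSdef
    have hSc : ∀ a ∈ A, ∀ v, S (a v) = a (S v) := by
      refine cutcomm _ fun a ha w _ => ?_
      rw [hN _ hs a ha]
    have hScut : ∀ v, S (e v) = S v := fun v => by
      change e ((star m * m) (e (e v))) = e ((star m * m) (e v)); rw [hee]
    have hcomm : S * T = T * S := cut_commute hA hSc hTc hScut hTcut (fun v => hee _) hTcut'
    have hesa : star e = e := by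
      refine ContinuousLinearMap.ext fun v => ext_inner_left ℂ fun w => ?_
      rw [inner_star, he, jonesProj_inner]
    have hSpos : 0 ≤ S := by
      have : S = star (m * e) * (m * e) := by
        rw [hSdef, star_mul, hesa]; simp only [mul_assoc]
      rw [this]; exact star_mul_self_nonneg _
    have hSsa : star S = S := (IsSelfAdjoint.of_nonneg hSpos).star_eq
    have hcomm' : S * star T = star T * S := by
      have := congrArg star hcomm
      rw [star_mul S T, star_mul T S, hSsa] at this
      exact this.symm
    have hDpos : 0 ≤ ((‖T‖ ^ 2 : ℝ) : ℂ) • (1 : H →L[ℂ] H) - star T * T := by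
      have := CStarAlgebra.star_mul_le_algebraMap_norm_sq (a := T)
      rw [sub_nonneg]
      convert this using 1
      rw [Algebra.algebraMap_eq_smul_one]
      ext v; simp; norm_cast
    have hcommD : Commute S (((‖T‖ ^ 2 : ℝ) : ℂ) • (1 : H →L[ℂ] H) - star T * T) := by
      refine Commute.sub_right ((Commute.one_right S).smul_right _) ?_
      exact Commute.mul_right hcomm' hcomm
    have hprod := Commute.mul_nonneg hSpos hDpos hcommD
    have hp := (ContinuousLinearMap.nonneg_iff_isPositive _).1 hprod
    have hp2 := hp.re_inner_nonneg_right Ω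
    have e1 : ∀ w, w ∈ masaL2 A Ω → ⟪w, S w⟫_ℂ = ((‖m w‖ ^ 2 : ℝ) : ℂ) := by
      intro w hw
      change ⟪w, e (star m (m (e w)))⟫_ℂ = _
      rw [he, ← jonesProj_inner, jonesProj_of_mem hw, inner_star,
        inner_self_eq_norm_sq_to_K]
      simp
    have hTm : T Ω ∈ masaL2 A Ω := hTΩ ▸ jonesProj_mem _
    have hΩm : Ω ∈ masaL2 A Ω := apply_mem_masaL2 (a := 1) (one_mem A)
    have e2 : ⟪Ω, (S * (((‖T‖ ^ 2 : ℝ) : ℂ) • (1 : H →L[ℂ] H) - star T * T)) Ω⟫_ℂ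
        = ((‖T‖ ^ 2 * ‖m Ω‖ ^ 2 - ‖m ξ‖ ^ 2 : ℝ) : ℂ) := by
      have e3 : S (star T (T Ω)) = star T (S (T Ω)) :=
        congrArg (fun t : H →L[ℂ] H => t (T Ω)) hcomm'
      have e4 := e1 Ω hΩm
      have e5 := e1 (T Ω) hTm
      rw [hTΩ] at e3 e5
      simp only [mul_apply_eq_comp, sub_apply,
        smul_apply, one_apply_eq_self, map_sub, map_smul,
        inner_sub_right, inner_smul_right, hTΩ]
      rw [e4, e3, inner_star, hTΩ, e5]
      push_cast; ring
    rw [e2] at hp2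
    have hp3 : ‖m ξ‖ ^ 2 ≤ (‖T‖ * ‖m Ω‖) ^ 2 := by
      have : 0 ≤ ‖T‖ ^ 2 * ‖m Ω‖ ^ 2 - ‖m ξ‖ ^ 2 := by
        rwa [RCLike.re_to_complex, Complex.ofReal_re] at hp2
      nlinarith
    exact (sq_le_sq₀ (norm_nonneg _) (by positivity)).1 hp3
  have hdense : DenseRange ev := by
    let K := (LinearMap.range ev).topologicalClosure
    have : CompleteSpace K := (Submodule.isClosed_topologicalClosure _).completeSpace_coe
    have hKinv : ∀ y ∈ A.commutant, K ∈ Module.End.invtSubmodule (y : H →ₗ[ℂ] H) := by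
      intro y hy
      rw [Module.End.mem_invtSubmodule_iff_forall_mem_of_mem]
      intro v hv
      have hcl : IsClosed {v | y v ∈ K} :=
        (Submodule.isClosed_topologicalClosure _).preimage y.continuous
      have : (K : Set H) ⊆ {v | y v ∈ K} := by
        refine closure_minimal ?_ hcl
        rintro _ ⟨m, rfl⟩
        exact subset_closure ⟨⟨y * m.1, mul_mem (S := VonNeumannAlgebra H) (s := N) hy m.2⟩, rfl⟩
      exact this hv
    have hp : K.starProjection ∈ A := by
      rw [VonNeumannAlgebra.IsStarProjection.mem_iff isStarProjection_starProjection]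
      intro y hy
      rw [Submodule.range_starProjection]
      exact hKinv y hy
    have hΩK : Ω ∈ K := subset_closure ⟨⟨1, one_mem N⟩, rfl⟩
    have hq : (1 : H →L[ℂ] H) - K.starProjection = 0 := by
      refine hM.faithful _ (hA.le (sub_mem (one_mem A) hp)) ?_
      have : ((1 : H →L[ℂ] H) - K.starProjection) Ω = 0 := by
        simp [Submodule.starProjection_eq_self_iff.2 hΩK]
      rw [mul_apply_eq_comp, this, map_zero, inner_zero_right]
    intro v
    have : K.starProjection v = v := by
      have := congrArg (fun t : H →L[ℂ] H => t v) hq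
      exact (sub_eq_zero.1 this).symm
    exact (this ▸ Submodule.starProjection_apply_mem K v : v ∈ K)
  let a : H →L[ℂ] H := fx.extendOfNorm ev
  have haev : ∀ m ∈ N, a (m Ω) = m ξ := fun m hm =>
    LinearMap.extendOfNorm_eq hdense ⟨_, hbound⟩ ⟨m, hm⟩
  refine ⟨a, ?_, by simpa using haev 1 (one_mem N)⟩
  rw [← VonNeumannAlgebra.commutant_commutant A, VonNeumannAlgebra.mem_commutant_iff]
  intro n hn
  ext v
  refine hdense.induction_on (p := fun v => (n * a) v = (a * n) v) v
    (isClosed_eq (by fun_prop) (by fun_prop)) fun m => ?_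
  change n (a (m.1 Ω)) = a ((n * m.1) Ω)
  rw [haev m.1 m.2, haev _ (mul_mem hn m.2)]
  rfl

/-- The trace-preserving normal conditional expectation `E_A : M → A`, the restriction to `M` of
the Jones projection: `E_A z` is the unique element of `A` with `(E_A z) Ω = e_A (z Ω)`. -/
noncomputable def masaCondExp (hM : IsIIOneStandardForm M Ω) (hA : IsMasa A M) (z : H →L[ℂ] H)
    (hz : z ∈ M) : H →L[ℂ] H :=
  (exists_masaCondExp hM hA hz).choose

theorem masaCondExp_mem (hM : IsIIOneStandardForm M Ω) (hA : IsMasa A M) {z : H →L[ℂ] H}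
    (hz : z ∈ M) : masaCondExp hM hA z hz ∈ A :=
  (exists_masaCondExp hM hA hz).choose_spec.1

theorem masaCondExp_apply (hM : IsIIOneStandardForm M Ω) (hA : IsMasa A M) {z : H →L[ℂ] H}
    (hz : z ∈ M) : masaCondExp hM hA z hz Ω = jonesProj A Ω (z Ω) :=
  (exists_masaCondExp hM hA hz).choose_spec.2

/-- `τ (c E_A(z)) = τ (c z)` for `c ∈ A`, which characterizes `E_A`. -/
theorem trace_mul_masaCondExp (hM : IsIIOneStandardForm M Ω) (hA : IsMasa A M) {z : H →L[ℂ] H}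
    (hz : z ∈ M) {c : H →L[ℂ] H} (hc : c ∈ A) :
    ⟪Ω, (c * masaCondExp hM hA z hz) Ω⟫_ℂ = ⟪Ω, (c * z) Ω⟫_ℂ := by
  rw [mul_apply_eq_comp, mul_apply_eq_comp, masaCondExp_apply, ← inner_star', ← inner_star' c,
    ← jonesProj_inner, jonesProj_of_mem (apply_mem_masaL2 (star_mem hc))]

end

section
variable {H : Type*} [NormedAddCommGroup H] [InnerProductSpace ℂ H] [CompleteSpace H]
  {X : Type*} [TopologicalSpace X] [CompactSpace X] [T2Space X] [SecondCountableTopology X]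
  [MeasurableSpace X] [BorelSpace X]

/-- `ι` embeds `C(X)` (`X` compact metrizable) as a unital, norm separable `C*`-subalgebra of `A`
that is dense in the weak operator topology, and `lam` is the tracial measure on `X`. -/
structure IsMasaCoordinates (A : VonNeumannAlgebra H) (Ω : H)
    (ι : C(X, ℂ) →⋆ₐ[ℂ] (H →L[ℂ] H)) (lam : Measure X) : Prop where
  injective : Function.Injective ι
  mem : ∀ f, ι f ∈ A
  dense : ∀ a ∈ A, ContinuousLinearMapWOT.ofCLM a ∈
    closure (Set.range fun f : C(X, ℂ) => ContinuousLinearMapWOT.ofCLM (ι f))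
  integral_eq : ∀ f : C(X, ℂ), ∫ t, f t ∂lam = ⟪Ω, ι f Ω⟫_ℂ

/-- The element `a` of `A` is the function `φ` under the identification `A ≅ L^∞(X, lam)` that
extends `ι`: on `L²(A)`, identified with `L²(X, lam)` through `ι g Ω ↔ g`, the operator `a` acts as
multiplication by `φ`. This determines `φ` up to a `lam`-null set. -/
def IsFunctionOf (Ω : H) (ι : C(X, ℂ) →⋆ₐ[ℂ] (H →L[ℂ] H)) (lam : Measure X)
    (a : H →L[ℂ] H) (φ : X → ℂ) : Prop :=
  MemLp φ ∞ lam ∧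
    ∀ g h : C(X, ℂ), ⟪ι g Ω, a (ι h Ω)⟫_ℂ = ∫ t, star (g t) * φ t * h t ∂lam

end

/-- The direct integral over `(Y, η)` of Hilbert spaces of dimension `m p` at `p`: the square
integrable sections of `ℓ²(ℕ)` whose value at `p` is supported on the first `m p` coordinates. -/
noncomputable def directIntegral {Y : Type*} [MeasurableSpace Y] (η : Measure Y) (m : Y → ℕ∞) :
    Submodule ℂ (Lp (lp (fun _ : ℕ => ℂ) 2) 2 η) where
  carrier := {F | ∀ᵐ p ∂η, ∀ i : ℕ, m p ≤ i → F p i = 0}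
  zero_mem' := by
    filter_upwards [Lp.coeFn_zero (lp (fun _ : ℕ => ℂ) 2) 2 η] with p hp i _
    rw [hp]; rfl
  add_mem' := by
    intro F G hF hG
    filter_upwards [hF, hG, Lp.coeFn_add F G] with p h1 h2 h3 i hi
    rw [h3, Pi.add_apply, lp.coeFn_add, Pi.add_apply, h1 i hi, h2 i hi, add_zero]
  smul_mem' := by
    intro c F hF
    filter_upwards [hF, Lp.coeFn_smul c F] with p h1 h2 i hi
    rw [h2, Pi.smul_apply, lp.coeFn_smul, Pi.smul_apply, h1 i hi, smul_zero]

section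
variable {H : Type*} [NormedAddCommGroup H] [InnerProductSpace ℂ H] [CompleteSpace H]
  {X : Type*} [TopologicalSpace X] [CompactSpace X] [T2Space X] [SecondCountableTopology X]
  [MeasurableSpace X] [BorelSpace X]

/-- The finite measure `η` on `X × X` and the multiplicity function `m` come from a direct integral
decomposition `W` of `L²(M)`, with nonzero fibres, as a bimodule over `A`: the left action of
`f ∈ C(X)` and the right action of `g ∈ C(X)` become multiplication by `f(t) g(s)`. (It is enough
to say this on the dense subspace `M Ω`, where `f · x · g = (f x g) Ω`.) Hence the diagonalizable
operators are exactly the von Neumann algebra generated by the left and right actions of `A`. -/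
def IsMeasureMultiplicity (M : VonNeumannAlgebra H) (Ω : H)
    (ι : C(X, ℂ) →⋆ₐ[ℂ] (H →L[ℂ] H)) (η : Measure (X × X)) (m : X × X → ℕ∞) : Prop :=
  IsFiniteMeasure η ∧ Measurable m ∧ (∀ᵐ p ∂η, m p ≠ 0) ∧
    ∃ W : H ≃ₗᵢ[ℂ] directIntegral η m, ∀ x ∈ M, ∀ f g : C(X, ℂ),
      ∀ᵐ p ∂η, (W ((ι f * x * ι g) Ω)).1 p = (f p.1 * g p.2) • (W (x Ω)).1 p

/-- The left-right measure, that is the class of `η` restricted to the complement of the diagonal,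
is the class of the product measure. -/
def IsProductClass (M : VonNeumannAlgebra H) (Ω : H)
    (ι : C(X, ℂ) →⋆ₐ[ℂ] (H →L[ℂ] H)) (lam : Measure X) : Prop :=
  ∃ (η : Measure (X × X)) (m : X × X → ℕ∞), IsMeasureMultiplicity M Ω ι η m ∧
    η.restrict (Set.diagonal X)ᶜ ≪ lam.prod lam ∧ lam.prod lam ≪ η.restrict (Set.diagonal X)ᶜ

end

/-!
A vector of `L²(M)` is a square-integrable section over `X × X`. Let `E_A(x) = 0`. All conjugates
`v x v*` by unitaries `v` of `C(X)` have the same restriction to the diagonal as `x`; by Dixmier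
averaging, `E_A(x) = 0` is a limit of their convex combinations in `L²(M)`, so that restriction
vanishes. Off the diagonal the measure of the decomposition is absolutely continuous with respect
to `λ ⊗ λ`. Hence the coefficient `(f, g) ↦ ⟪y, f x g⟫` is given by integration against an
integrable kernel `k` on `X × X`, and the trace property turns this into
`E_A(x u y*)(t) = ∫ k(t, s) u(s) dλ(s)`. For almost every `t` the function `k(t, ·)` is integrable,
and a bounded sequence `u_n` that tends weakly to `0` also tends to `0` against integrable
functions.
-/

section ContinuousTests
open scoped BoundedContinuousFunction NNReal
variable {X : Type*} [TopologicalSpace X] [MeasurableSpace X] [BorelSpace X] {μ : Measure X}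

theorem ae_eq_zero_of_forall_integral_boundedContinuous_smul [HasOuterApproxClosed X]
    {E : Type*} [NormedAddCommGroup E] [NormedSpace ℝ E] [CompleteSpace E] {q : X → E}
    (hq : Integrable q μ) (h : ∀ f : X →ᵇ ℝ≥0, ∫ t, f t • q t ∂μ = 0) : q =ᵐ[μ] 0 := by
  refine ae_eq_zero_of_forall_setIntegral_isClosed_eq_zero hq fun s hs => ?_
  have hlim : Tendsto (fun n => ∫ t, hs.apprSeq n t • q t ∂μ) atTop (𝓝 (∫ t in s, q t ∂μ)) := by
    rw [← integral_indicator hs.measurableSet]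
    refine tendsto_integral_of_dominated_convergence (fun t => ‖q t‖) (fun n => ?_) hq.norm
      (fun n => ae_of_all _ fun t => ?_) (ae_of_all _ fun t => ?_)
    · exact (hs.apprSeq n).continuous.measurable.aestronglyMeasurable.smul hq.1
    · rw [NNReal.smul_def, norm_smul, Real.norm_of_nonneg (NNReal.coe_nonneg _)]
      exact mul_le_of_le_one_left (norm_nonneg _)
        (HasOuterApproxClosed.apprSeq_apply_le_one hs n t)
    · have := (tendsto_pi_nhds.1 (HasOuterApproxClosed.tendsto_apprSeq hs) t).smul_const (q t)
      by_cases ht : t ∈ s <;> simpa [ht] using this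
  simp only [h] at hlim
  exact tendsto_nhds_unique hlim tendsto_const_nhds

theorem measure_le_of_forall_lintegral_boundedContinuous_le [HasOuterApproxClosed X]
    {ν : Measure X} [IsFiniteMeasure μ] [IsFiniteMeasure ν] [μ.WeaklyRegular]
    (h : ∀ f : X →ᵇ ℝ≥0, ∫⁻ t, f t ∂μ ≤ ∫⁻ t, f t ∂ν) : μ ≤ ν := by
  have hclosed : ∀ s, IsClosed s → μ s ≤ ν s := fun s hs =>
    ge_of_tendsto' (HasOuterApproxClosed.tendsto_lintegral_apprSeq hs ν) fun n =>
      (HasOuterApproxClosed.measure_le_lintegral hs μ n).trans (h _)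
  refine Measure.le_iff.2 fun s hs => ?_
  rw [hs.measure_eq_iSup_isClosed_of_ne_top (measure_ne_top _ _)]
  exact iSup₂_le fun F hF => iSup_le fun hFc => (hclosed F hFc).trans (measure_mono hF)

theorem tendsto_integral_mul_of_forall_boundedContinuous [NormalSpace X] [μ.WeaklyRegular]
    {ψ : ℕ → X → ℂ} {C : ℝ} (hψm : ∀ n, AEStronglyMeasurable (ψ n) μ)
    (hψ : ∀ n, ∀ᵐ t ∂μ, ‖ψ n t‖ ≤ C)
    (h : ∀ f : X →ᵇ ℂ, Integrable f μ → Tendsto (fun n => ∫ t, f t * ψ n t ∂μ) atTop (𝓝 0))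
    {k : X → ℂ} (hk : Integrable k μ) :
    Tendsto (fun n => ∫ t, k t * ψ n t ∂μ) atTop (𝓝 0) := by
  rw [Metric.tendsto_atTop]
  intro ε hε
  obtain ⟨g, hg, hgi⟩ := hk.exists_boundedContinuous_integral_sub_le
    (show 0 < ε / (2 * (|C| + 1)) by positivity)
  obtain ⟨N, hN⟩ := Metric.tendsto_atTop.1 (h g hgi) (ε / 2) (by positivity)
  refine ⟨N, fun n hn => ?_⟩
  have hsplit : ∫ t, k t * ψ n t ∂μ
      = (∫ t, (k t - g t) * ψ n t ∂μ) + ∫ t, g t * ψ n t ∂μ := by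
    simp only [sub_mul]
    rw [integral_sub (hk.mul_bdd (hψm n) (hψ n)) (hgi.mul_bdd (hψm n) (hψ n)), sub_add_cancel]
  have herror : ‖∫ t, (k t - g t) * ψ n t ∂μ‖ ≤ ε / 2 := calc
    _ ≤ ∫ t, ‖k t - g t‖ * (|C| + 1) ∂μ := by
      refine norm_integral_le_of_norm_le ((hk.sub hgi).norm.mul_const _) ?_
      filter_upwards [hψ n] with t ht
      rw [norm_mul]
      gcongr
      exact ht.trans ((le_abs_self C).trans (by linarith))
    _ ≤ ε / (2 * (|C| + 1)) * (|C| + 1) := by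
      rw [integral_mul_const]
      gcongr
    _ = ε / 2 := by field_simp
  have hmain := hN n hn
  rw [dist_zero_right] at hmain ⊢
  rw [hsplit]
  exact (norm_add_le _ _).trans_lt (by linarith)

variable [CompactSpace X]

theorem ae_eq_of_forall_integral_continuousMap_mul [HasOuterApproxClosed X] {q r : X → ℂ}
    (hq : Integrable q μ) (hr : Integrable r μ)
    (h : ∀ f : C(X, ℂ), ∫ t, f t * q t ∂μ = ∫ t, f t * r t ∂μ) : q =ᵐ[μ] r := by
  refine (ae_eq_zero_of_forall_integral_boundedContinuous_smul (hq.sub hr) fun f => ?_).mono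
    fun t ht => sub_eq_zero.1 ht
  let g : C(X, ℂ) := ⟨fun t => ((f t : ℝ) : ℂ), by fun_prop⟩
  have hg : ∀ {p : X → ℂ}, Integrable p μ → Integrable (fun t => g t * p t) μ := fun hp =>
    hp.bdd_mul g.continuous.measurable.aestronglyMeasurable
      (ae_of_all _ fun t => g.norm_coe_le_norm t)
  have hsmul : ∀ t, f t • (q - r) t = g t * q t - g t * r t := fun t => by
    rw [Pi.sub_apply, ← mul_sub]
    rfl
  simp only [hsmul]
  rw [integral_sub (hg hq) (hg hr), h g, sub_self]

theorem ae_enorm_le_of_forall_lintegral_continuousMap_mul [IsFiniteMeasure μ]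
    [TopologicalSpace.PseudoMetrizableSpace X] {q : X → ℂ}
    (hq : AEStronglyMeasurable q μ) {K : ℝ≥0∞} (hK : K ≠ ∞)
    (h : ∀ f : C(X, ℂ), ∫⁻ t, ‖f t * q t‖ₑ ^ 2 ∂μ ≤ K ^ 2 * ∫⁻ t, ‖f t‖ₑ ^ 2 ∂μ) :
    ∀ᵐ t ∂μ, ‖q t‖ₑ ≤ K := by
  have hqm : AEMeasurable (fun t => ‖q t‖ₑ ^ 2) μ := hq.enorm.pow_const 2
  have hKμ : IsFiniteMeasure (K ^ 2 • μ) := μ.smul_finite (ENNReal.pow_ne_top hK)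
  have : IsFiniteMeasure (μ.withDensity fun t => ‖q t‖ₑ ^ 2) := by
    refine isFiniteMeasure_withDensity
      (ne_top_of_le_ne_top (measure_ne_top (K ^ 2 • μ) Set.univ) ?_)
    simpa using h 1
  have hle : μ.withDensity (fun t => ‖q t‖ₑ ^ 2) ≤ K ^ 2 • μ := by
    refine measure_le_of_forall_lintegral_boundedContinuous_le fun f => ?_
    let g : C(X, ℂ) := ⟨fun t => ((NNReal.sqrt (f t) : ℝ) : ℂ), by fun_prop⟩
    have hg : ∀ t, ‖g t‖ₑ ^ 2 = f t := fun t => by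
      have : ‖g t‖₊ = NNReal.sqrt (f t) := by
        ext
        simp [g]
      rw [enorm_eq_nnnorm, this, ← ENNReal.coe_pow, NNReal.sq_sqrt]
    rw [lintegral_withDensity_eq_lintegral_mul₀ hqm
      f.continuous.measurable.coe_nnreal_ennreal.aemeasurable, lintegral_smul_measure]
    simpa only [enorm_mul, mul_pow, hg, Pi.mul_apply, mul_comm, smul_eq_mul] using h g
  have hsq : (fun t => ‖q t‖ₑ ^ 2) ≤ᵐ[μ] fun _ => K ^ 2 := by
    refine ae_le_of_forall_setLIntegral_le_of_sigmaFinite₀ hqm fun s hs _ => ?_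
    rw [setLIntegral_const, ← withDensity_apply _ hs]
    exact hle s
  exact hsq.mono fun t ht => (ENNReal.pow_le_pow_left_iff two_ne_zero).1 ht

end ContinuousTests

theorem enorm_sq_eq_lintegral {X : Type*} [MeasurableSpace X] {μ : Measure X}
    {E : Type*} [NormedAddCommGroup E] (ξ : Lp E 2 μ) : ‖ξ‖ₑ ^ 2 = ∫⁻ t, ‖ξ t‖ₑ ^ 2 ∂μ := by
  have := eLpNorm_nnreal_pow_eq_lintegral (μ := μ) (f := ξ) (p := 2) two_ne_zero
  rw [Lp.enorm_def]
  simpa using this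

theorem inner_map_star {H : Type*} [NormedAddCommGroup H] [InnerProductSpace ℂ H] [CompleteSpace H]
    {X : Type*} [TopologicalSpace X] (ι : C(X, ℂ) →⋆ₐ[ℂ] (H →L[ℂ] H)) (f : C(X, ℂ)) (v w : H) :
    ⟪ι (star f) v, w⟫_ℂ = ⟪v, ι f w⟫_ℂ := by
  rw [map_star, inner_star']

instance {H : Type*} [NormedAddCommGroup H] [InnerProductSpace ℂ H] [CompleteSpace H]
    (A : VonNeumannAlgebra H) (Ω : H) : CompleteSpace (masaL2 A Ω) :=
  (Submodule.isClosed_topologicalClosure _).completeSpace_coe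

section MasaCoordinates
variable {H : Type*} [NormedAddCommGroup H] [InnerProductSpace ℂ H] [CompleteSpace H]
  {A M : VonNeumannAlgebra H} {Ω : H}
  {X : Type*} [TopologicalSpace X] [MeasurableSpace X]
  {ι : C(X, ℂ) →⋆ₐ[ℂ] (H →L[ℂ] H)} {lam : Measure X}

namespace IsMasaCoordinates

/-- The map `f ↦ ι f Ω` from `C(X)` to `L²(A)`. -/
noncomputable def orbitMap (hX : IsMasaCoordinates A Ω ι lam) : C(X, ℂ) →ₗ[ℂ] masaL2 A Ω :=
  ((ContinuousLinearMap.apply ℂ H Ω).toLinearMap.comp ι.toAlgHom.toLinearMap).codRestrict _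
    fun f => apply_mem_masaL2 (hX.mem f)

theorem denseRange_orbitMap (hX : IsMasaCoordinates A Ω ι lam) : DenseRange hX.orbitMap := by
  let S := LinearMap.range hX.orbitMap
  suffices S.topologicalClosure = ⊤ from
    (Submodule.dense_iff_topologicalClosure_eq_top (s := S)).2 this
  rw [Submodule.topologicalClosure_eq_top_iff, Submodule.eq_bot_iff]
  refine fun v hv => Subtype.ext (eq_of_mem_masaL2 v.2 (zero_mem _) fun a ha => ?_)
  rw [Submodule.coe_zero, inner_zero_right, inner_eq_zero_symm]
  have hclosed : IsClosed {T : H →WOT[ℂ] H | ⟪(v : H), T Ω⟫_ℂ = 0} :=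
    isClosed_eq (ContinuousLinearMapWOT.continuous_dual_apply Ω (innerSL ℂ (v : H)))
      continuous_const
  refine closure_minimal ?_ hclosed (hX.dense a ha)
  rintro _ ⟨f, rfl⟩
  exact inner_eq_zero_symm.1 ((Submodule.mem_orthogonal S v).1 hv _ (LinearMap.mem_range_self _ f))

variable [CompactSpace X] [BorelSpace X] [IsFiniteMeasure lam]

theorem inner_map_map (hX : IsMasaCoordinates A Ω ι lam) (f g : C(X, ℂ)) :
    ⟪ι f Ω, ι g Ω⟫_ℂ
      = ⟪ContinuousMap.toLp 2 lam ℂ f, ContinuousMap.toLp 2 lam ℂ g⟫_ℂ := by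
  rw [ContinuousMap.inner_toLp, ← inner_star, ← map_star, ← mul_apply_eq_comp, ← map_mul,
    ← hX.integral_eq]
  simp [mul_comm]

theorem norm_map (hX : IsMasaCoordinates A Ω ι lam) (f : C(X, ℂ)) :
    ‖ι f Ω‖ = ‖ContinuousMap.toLp (E := ℂ) 2 lam ℂ f‖ := by
  rw [@norm_eq_sqrt_re_inner ℂ, @norm_eq_sqrt_re_inner ℂ, hX.inner_map_map]

variable [T2Space X] [SecondCountableTopology X]

/-- The identification of `L²(X, lam)` with `L²(A)` that extends `f ↦ ι f Ω`. -/
noncomputable def equivMasaL2 (hX : IsMasaCoordinates A Ω ι lam) : Lp ℂ 2 lam ≃ₗᵢ[ℂ] masaL2 A Ω :=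
  (LinearEquiv.refl ℂ C(X, ℂ)).extendOfIsometry (ContinuousMap.toLp (E := ℂ) 2 lam ℂ).toLinearMap
    hX.orbitMap (ContinuousMap.toLp_denseRange ℂ lam ℂ (by simp)) hX.denseRange_orbitMap
    hX.norm_map

theorem equivMasaL2_toLp (hX : IsMasaCoordinates A Ω ι lam) (f : C(X, ℂ)) :
    (hX.equivMasaL2 (ContinuousMap.toLp 2 lam ℂ f) : H) = ι f Ω :=
  congrArg Subtype.val (LinearEquiv.extendOfIsometry_eq _ _ _ _ _ _ f)

/-- The projection of `L²(M)` onto `L²(A)`, read as a function on `X`. -/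
noncomputable def toL2 (hX : IsMasaCoordinates A Ω ι lam) : H →L[ℂ] Lp ℂ 2 lam :=
  hX.equivMasaL2.symm.toContinuousLinearEquiv.toContinuousLinearMap.comp
    (masaL2 A Ω).orthogonalProjectionOnto

theorem inner_toL2 (hX : IsMasaCoordinates A Ω ι lam) (ξ : Lp ℂ 2 lam) (w : H) :
    ⟪ξ, hX.toL2 w⟫_ℂ = ⟪(hX.equivMasaL2 ξ : H), w⟫_ℂ := by
  rw [← hX.equivMasaL2.inner_map_map]
  simp [toL2]

theorem equivMasaL2_toL2 (hX : IsMasaCoordinates A Ω ι lam) {a : H →L[ℂ] H} (ha : a ∈ A) :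
    (hX.equivMasaL2 (hX.toL2 (a Ω)) : H) = a Ω := by
  simpa [toL2, jonesProj] using jonesProj_of_mem (apply_mem_masaL2 ha)

theorem norm_toL2_le (hX : IsMasaCoordinates A Ω ι lam) (w : H) : ‖hX.toL2 w‖ ≤ ‖w‖ :=
  (hX.equivMasaL2.symm.norm_map _).trans_le ((masaL2 A Ω).norm_orthogonalProjectionOnto_apply_le w)

theorem integrable_toL2 (hX : IsMasaCoordinates A Ω ι lam) (w : H) :
    Integrable (hX.toL2 w) lam :=
  (Lp.memLp (hX.toL2 w)).integrable one_le_two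

theorem inner_map_eq_integral (hX : IsMasaCoordinates A Ω ι lam) (f : C(X, ℂ)) (w : H) :
    ⟪ι f Ω, w⟫_ℂ = ∫ t, star (f t) * hX.toL2 w t ∂lam := by
  rw [← hX.equivMasaL2_toLp, ← hX.inner_toL2, L2.inner_def]
  refine integral_congr_ae ?_
  filter_upwards [f.coeFn_toLp (p := 2) (𝕜 := ℂ) lam] with t ht
  rw [ht, RCLike.inner_apply, mul_comm]
  rfl

theorem inner_map_star_eq_integral (hX : IsMasaCoordinates A Ω ι lam) (f : C(X, ℂ)) (w : H) :
    ⟪ι (star f) Ω, w⟫_ℂ = ∫ t, f t * hX.toL2 w t ∂lam := by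
  simp [hX.inner_map_eq_integral]

theorem toL2_map_apply (hX : IsMasaCoordinates A Ω ι lam) (f : C(X, ℂ)) (w : H) :
    hX.toL2 (ι f w) =ᵐ[lam] fun t => f t * hX.toL2 w t := by
  refine ae_eq_of_forall_integral_continuousMap_mul (hX.integrable_toL2 _)
    ((hX.integrable_toL2 w).bdd_mul f.continuous.aestronglyMeasurable
      (ae_of_all _ fun t => f.norm_coe_le_norm t)) fun g => ?_
  rw [← hX.inner_map_star_eq_integral, ← inner_map_star, ← mul_apply_eq_comp, ← map_mul,
    ← star_mul, hX.inner_map_star_eq_integral]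
  simp [mul_assoc]

theorem norm_toL2_apply_le (hX : IsMasaCoordinates A Ω ι lam) (hA : IsMasa A M)
    {a : H →L[ℂ] H} (ha : a ∈ A) : ∀ᵐ t ∂lam, ‖hX.toL2 (a Ω) t‖ ≤ ‖a‖ := by
  have hbound : ∀ f, ‖hX.toL2 (ι f (a Ω))‖ ≤ ‖a‖ * ‖ContinuousMap.toLp (E := ℂ) 2 lam ℂ f‖ :=
    fun f => calc
      _ ≤ ‖ι f (a Ω)‖ := hX.norm_toL2_le _
      _ = ‖a (ι f Ω)‖ := by rw [← mul_apply_eq_comp, hA.comm _ (hX.mem f) _ ha]; rfl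
      _ ≤ ‖a‖ * ‖ContinuousMap.toLp (E := ℂ) 2 lam ℂ f‖ := by
        rw [← hX.norm_map]
        exact a.le_opNorm _
  refine (ae_enorm_le_of_forall_lintegral_continuousMap_mul (Lp.aestronglyMeasurable _)
    (enorm_ne_top (x := a)) fun f => ?_).mono fun t ht => enorm_le_iff_norm_le.1 ht
  calc ∫⁻ t, ‖f t * hX.toL2 (a Ω) t‖ₑ ^ 2 ∂lam
      = ‖hX.toL2 (ι f (a Ω))‖ₑ ^ 2 := by
        rw [enorm_sq_eq_lintegral]
        exact lintegral_congr_ae ((hX.toL2_map_apply f (a Ω)).mono fun t ht => by simp only [ht])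
    _ ≤ (‖a‖ₑ * ‖ContinuousMap.toLp (E := ℂ) 2 lam ℂ f‖ₑ) ^ 2 := by
        gcongr
        simp only [← ofReal_norm]
        rw [← ENNReal.ofReal_mul (norm_nonneg _)]
        exact ENNReal.ofReal_le_ofReal (hbound f)
    _ = ‖a‖ₑ ^ 2 * ∫⁻ t, ‖f t‖ₑ ^ 2 ∂lam := by
        rw [mul_pow, enorm_sq_eq_lintegral]
        congr 1
        exact lintegral_congr_ae ((f.coeFn_toLp (p := 2) (𝕜 := ℂ) lam).mono fun t ht => by
          simp only [ht])

theorem isFunctionOf_toL2 (hX : IsMasaCoordinates A Ω ι lam) (hA : IsMasa A M)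
    {a : H →L[ℂ] H} (ha : a ∈ A) : IsFunctionOf Ω ι lam a (hX.toL2 (a Ω)) := by
  refine ⟨memLp_top_of_bound (Lp.aestronglyMeasurable _) ‖a‖ (hX.norm_toL2_apply_le hA ha),
    fun g h => ?_⟩
  have hcomm : a (ι h Ω) = ι h (a Ω) :=
    congrArg (fun T : H →L[ℂ] H => T Ω) (hA.comm _ ha _ (hX.mem h))
  rw [hcomm, hX.inner_map_eq_integral]
  refine integral_congr_ae ((hX.toL2_map_apply h (a Ω)).mono fun t ht => ?_)
  simp only [ht]
  ring

theorem inner_apply_eq_integral (hX : IsMasaCoordinates A Ω ι lam)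
    {a : H →L[ℂ] H} (ha : a ∈ A) (w : H) :
    ⟪w, a Ω⟫_ℂ = ∫ t, star (hX.toL2 w t) * hX.toL2 (a Ω) t ∂lam := by
  have hinner : ⟪w, a Ω⟫_ℂ = ⟪hX.toL2 w, hX.toL2 (a Ω)⟫_ℂ := by
    rw [← inner_conj_symm _ (hX.toL2 _), hX.inner_toL2, hX.equivMasaL2_toL2 ha, inner_conj_symm]
  rw [hinner, L2.inner_def]
  refine integral_congr_ae (ae_of_all _ fun t => ?_)
  simp only [RCLike.inner_apply, mul_comm, starRingEnd_apply]

theorem tendsto_integral_mul_toL2 (hX : IsMasaCoordinates A Ω ι lam) {u : ℕ → H →L[ℂ] H}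
    (hu : Tendsto (fun n => ContinuousLinearMapWOT.ofCLM (u n)) atTop
      (𝓝 (0 : H →WOT[ℂ] H))) (f : C(X, ℂ)) :
    Tendsto (fun n => ∫ t, f t * hX.toL2 (u n Ω) t ∂lam) atTop (𝓝 0) := by
  have h := ((ContinuousLinearMapWOT.continuous_dual_apply Ω
    (innerSL ℂ (ι (star f) Ω))).tendsto (0 : H →WOT[ℂ] H)).comp hu
  simp only [← hX.inner_map_star_eq_integral]
  simpa [Function.comp_def] using h

end IsMasaCoordinates

theorem IsFunctionOf.ae_eq [CompactSpace X] [BorelSpace X] [T2Space X] [SecondCountableTopology X]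
    [IsFiniteMeasure lam] {a : H →L[ℂ] H} {φ ψ : X → ℂ} (hφ : IsFunctionOf Ω ι lam a φ)
    (hψ : IsFunctionOf Ω ι lam a ψ) : φ =ᵐ[lam] ψ := by
  refine ae_eq_of_forall_integral_continuousMap_mul (hφ.1.integrable le_top)
    (hψ.1.integrable le_top) fun f => ?_
  simpa [mul_comm] using (hφ.2 1 f).symm.trans (hψ.2 1 f)

end MasaCoordinates

/-- `Ω` is a separating vector of `M`. -/
def IsSeparatingVector {H : Type*} [NormedAddCommGroup H] [InnerProductSpace ℂ H] [CompleteSpace H]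
    (M : VonNeumannAlgebra H) (Ω : H) : Prop :=
  ∀ x ∈ M, x Ω = 0 → x = 0

section SeparatingVector
variable {H : Type*} [NormedAddCommGroup H] [InnerProductSpace ℂ H] [CompleteSpace H]
  {A M : VonNeumannAlgebra H} {Ω : H}

theorem IsIIOneStandardForm.isSeparatingVector (hM : IsIIOneStandardForm M Ω) :
    IsSeparatingVector M Ω := fun x hx h =>
  hM.faithful x hx (by rw [mul_apply_eq_comp, h, map_zero, inner_zero_right])

theorem commutant_apply_comm {x t : H →L[ℂ] H} (hx : x ∈ M) (ht : t ∈ M.commutant) (v : H) :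
    t (x v) = x (t v) :=
  congrArg (fun T : H →L[ℂ] H => T v) (VonNeumannAlgebra.mem_commutant_iff.1 ht x hx).symm

theorem jonesProj_mem_commutant (A : VonNeumannAlgebra H) (Ω : H) :
    jonesProj A Ω ∈ A.commutant :=
  VonNeumannAlgebra.mem_commutant_iff.2 fun _ ha =>
    ContinuousLinearMap.ext fun v => (jonesProj_comm ha v).symm

theorem IsSeparatingVector.masaL2_commutant (hΩ : IsSeparatingVector M Ω) :
    masaL2 M.commutant Ω = ⊤ := by
  have hproj : jonesProj M.commutant Ω ∈ M := by
    simpa only [VonNeumannAlgebra.commutant_commutant] using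
      jonesProj_mem_commutant M.commutant Ω
  have hfix : jonesProj M.commutant Ω Ω = Ω :=
    jonesProj_of_mem (apply_mem_masaL2 (a := 1) (one_mem M.commutant))
  have hone : 1 - jonesProj M.commutant Ω = 0 :=
    hΩ _ (sub_mem (one_mem M) hproj) (by simp [hfix])
  refine Submodule.eq_top_iff'.2 fun v => ?_
  have hv : jonesProj M.commutant Ω v = v := by rw [← sub_eq_zero.1 hone, one_apply_eq_self]
  exact hv ▸ jonesProj_mem v

theorem IsSeparatingVector.exists_mem_apply_eq (hΩ : IsSeparatingVector M Ω) {v : H} {K : ℝ}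
    (h : ∀ t ∈ M.commutant, ‖t v‖ ≤ K * ‖t Ω‖) : ∃ a ∈ M, a Ω = v := by
  let orbit (w : H) := (ContinuousLinearMap.apply ℂ H w).toLinearMap.comp
    M.commutant.toStarSubalgebra.toSubalgebra.toSubmodule.subtype
  have hdense : DenseRange (orbit Ω) := by
    rw [DenseRange, ← LinearMap.coe_range, Submodule.dense_iff_topologicalClosure_eq_top,
      LinearMap.range_comp, Submodule.range_subtype]
    exact hΩ.masaL2_commutant
  let a : H →L[ℂ] H := (orbit v).extendOfNorm (orbit Ω)
  have ha : ∀ t ∈ M.commutant, a (t Ω) = t v := fun t ht =>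
    LinearMap.extendOfNorm_eq hdense ⟨K, fun s => h s.1 s.2⟩ ⟨t, ht⟩
  refine ⟨a, ?_, by simpa using ha 1 (one_mem _)⟩
  rw [← VonNeumannAlgebra.commutant_commutant M, VonNeumannAlgebra.mem_commutant_iff]
  intro n hn
  ext w
  refine hdense.induction_on (p := fun w => (n * a) w = (a * n) w) w
    (isClosed_eq (by fun_prop) (by fun_prop)) fun t => ?_
  change n (a (t.1 Ω)) = a ((n * t.1) Ω)
  rw [ha t.1 t.2, ha _ (mul_mem hn t.2), mul_apply_eq_comp]

end SeparatingVector

section Masa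
variable {H : Type*} [NormedAddCommGroup H] [InnerProductSpace ℂ H] [CompleteSpace H]
  {A M : VonNeumannAlgebra H} {Ω : H} {a : H →L[ℂ] H}

theorem IsMasa.mem_of_isSelfAdjoint_of_mem_commutant (hA : IsMasa A M) (haM : a ∈ M)
    (hsa : IsSelfAdjoint a) (ha : a ∈ A.commutant) : a ∈ A := by
  have hcommA : ∀ b ∈ A, b * a = a * b := VonNeumannAlgebra.mem_commutant_iff.1 ha
  have hcomm : ∀ x ∈ insert a (A : Set (H →L[ℂ] H)), ∀ y ∈ insert a (A : Set (H →L[ℂ] H)),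
      x * y = y * x := by
    rintro x (rfl | hx) y (rfl | hy)
    · rfl
    · exact (hcommA y hy).symm
    · exact hcommA x hx
    · exact hA.comm x hx y hy
  have hstar : ∀ x ∈ insert a (A : Set (H →L[ℂ] H)), star x ∈ insert a (A : Set (H →L[ℂ] H)) := by
    rintro x (rfl | hx)
    · exact Or.inl hsa
    · exact Or.inr (star_mem (s := A) hx)
  have hadjoin := StarAlgebra.isMulCommutative_adjoin (R := ℂ) hcomm
    fun x hx y hy => hcomm x hx _ (hstar y hy)
  have hle : StarAlgebra.adjoin ℂ (insert a (A : Set (H →L[ℂ] H))) ≤ M.toStarSubalgebra :=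
    StarAlgebra.adjoin_le (Set.insert_subset haM fun b hb => hA.le hb)
  exact hA.maximal _ (fun b hb => hle hb)
    (fun x hx y hy => congrArg Subtype.val (hadjoin.is_comm.comm ⟨x, hx⟩ ⟨y, hy⟩))
    (fun b hb => StarAlgebra.subset_adjoin ℂ _ (Or.inr hb)) a
    (StarAlgebra.subset_adjoin ℂ _ (Or.inl rfl))

theorem IsMasa.mem_of_mem_commutant (hA : IsMasa A M) (haM : a ∈ M) (ha : a ∈ A.commutant) :
    a ∈ A := by
  have hre : a + star a ∈ A :=
    hA.mem_of_isSelfAdjoint_of_mem_commutant (add_mem haM (star_mem haM))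
      (IsSelfAdjoint.add_star_self a) (add_mem ha (star_mem ha))
  have him : Complex.I • (a - star a) ∈ A :=
    hA.mem_of_isSelfAdjoint_of_mem_commutant
      (M.toStarSubalgebra.smul_mem (sub_mem haM (star_mem haM)) _)
      (by simp [isSelfAdjoint_iff, ← smul_neg])
      (A.commutant.toStarSubalgebra.smul_mem (sub_mem ha (star_mem ha)) _)
  have hdecomp : a = (1 / 2 : ℂ) • (a + star a) + (-Complex.I / 2) • Complex.I • (a - star a) := by
    rw [smul_smul, div_mul_eq_mul_div, neg_mul, Complex.I_mul_I, neg_neg]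
    module
  rw [hdecomp]
  exact add_mem (A.toStarSubalgebra.smul_mem hre _) (A.toStarSubalgebra.smul_mem him _)

theorem IsMasaCoordinates.mem_commutant_of_commute {X : Type*} [TopologicalSpace X]
    [MeasurableSpace X] {ι : C(X, ℂ) →⋆ₐ[ℂ] (H →L[ℂ] H)} {lam : Measure X}
    (hX : IsMasaCoordinates A Ω ι lam) (h : ∀ f, Commute (ι f) a) : a ∈ A.commutant := by
  refine VonNeumannAlgebra.mem_commutant_iff.2 fun b hb =>
    ContinuousLinearMap.ext fun v => ext_inner_left ℂ fun w => ?_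
  have hclosed : IsClosed {T : H →WOT[ℂ] H | ⟪w, T (a v)⟫_ℂ = ⟪star a w, T v⟫_ℂ} :=
    isClosed_eq (ContinuousLinearMapWOT.continuous_dual_apply (a v) (innerSL ℂ w))
      (ContinuousLinearMapWOT.continuous_dual_apply v (innerSL ℂ (star a w)))
  refine (closure_minimal ?_ hclosed (hX.dense b hb)).trans (inner_star' a w (b v))
  rintro _ ⟨f, rfl⟩
  exact (congrArg (fun T : H →L[ℂ] H => ⟪w, T v⟫_ℂ) (h f)).trans (inner_star' a w (ι f v)).symm

end Masa

theorem exists_mem_forall_norm_le_imp_eq {E : Type*} [NormedAddCommGroup E]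
    [InnerProductSpace ℝ E] [CompleteSpace E] {K : Set E} (hne : K.Nonempty) (hK : IsClosed K)
    (hconv : Convex ℝ K) : ∃ v ∈ K, ∀ w ∈ K, ‖w‖ ≤ ‖v‖ → w = v := by
  obtain ⟨v, hv, hmin⟩ := exists_norm_eq_iInf_of_complete_convex hne hK.isComplete hconv 0
  refine ⟨v, hv, fun w hw hwv => ?_⟩
  have hvw : ⟪v, v⟫_ℝ ≤ ⟪v, w⟫_ℝ := by
    simpa [inner_sub_right] using (norm_eq_iInf_iff_real_inner_le_zero hconv hv).1 hmin w hw
  have hsub : ‖w - v‖ * ‖w - v‖ ≤ 0 := by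
    rw [norm_sub_mul_self_real]
    rw [real_inner_self_eq_norm_mul_norm, real_inner_comm] at hvw
    nlinarith [mul_self_le_mul_self (norm_nonneg w) hwv]
  exact sub_eq_zero.1 (norm_eq_zero.1 (mul_self_eq_zero.1 (hsub.antisymm (mul_self_nonneg _))))

section Conjugates
variable {H : Type*} [NormedAddCommGroup H] [InnerProductSpace ℂ H] [CompleteSpace H]
  {A M : VonNeumannAlgebra H} {Ω : H} {U : Submonoid (H →L[ℂ] H)} {u x z : H →L[ℂ] H}

/-- The convex hull of the conjugates `u z u*` with `u ∈ U`, whose elements are the averages of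
Dixmier's averaging theorem when `U` consists of unitaries. -/
def conjHull (U : Submonoid (H →L[ℂ] H)) (z : H →L[ℂ] H) : Set (H →L[ℂ] H) :=
  convexHull ℝ {x | ∃ u ∈ U, u * z * star u = x}

theorem conjHull_subset {s : Set (H →L[ℂ] H)} (hs : Convex ℝ s)
    (h : ∀ u ∈ U, u * z * star u ∈ s) : conjHull U z ⊆ s :=
  convexHull_min (by rintro _ ⟨u, hu, rfl⟩; exact h u hu) hs

theorem conj_mem_conjHull (hu : u ∈ U) (hx : x ∈ conjHull U z) :
    u * x * star u ∈ conjHull U z := by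
  let conj : (H →L[ℂ] H) →ₗ[ℝ] (H →L[ℂ] H) := LinearMap.mulLeftRight ℝ (u, star u)
  refine conjHull_subset (s := conj ⁻¹' conjHull U z)
    ((convex_convexHull ℝ _).linear_preimage conj) (fun v hv => ?_) hx
  refine subset_convexHull ℝ _ ⟨u * v, mul_mem hu hv, ?_⟩
  simp [conj, mul_assoc]

theorem conjHull_subset_vonNeumannAlgebra (hU : ∀ u ∈ U, u ∈ M) (hz : z ∈ M) :
    conjHull U z ⊆ M := by
  have hconv : Convex ℝ (M : Set (H →L[ℂ] H)) :=
    (M.toStarSubalgebra.toSubalgebra.toSubmodule.restrictScalars ℝ).convex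
  exact conjHull_subset hconv fun u hu =>
    mul_mem (S := VonNeumannAlgebra H) (mul_mem (hU u hu) hz) (star_mem (hU u hu))

theorem apply_eq_of_mem_closure_conjHull {φ : H →L[ℂ] ℂ} {c : ℂ}
    (h : ∀ u ∈ U, φ ((u * z * star u) Ω) = c) {v : H}
    (hv : v ∈ closure ((fun y : H →L[ℂ] H => y Ω) '' conjHull U z)) : φ v = c := by
  refine closure_minimal (t := {v | φ v = c}) ?_ (isClosed_eq (by fun_prop) continuous_const) hv
  rintro _ ⟨y, hy, rfl⟩
  let ψ : (H →L[ℂ] H) →ₗ[ℝ] ℂ :=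
    (φ.toLinearMap.comp (ContinuousLinearMap.apply ℂ H Ω).toLinearMap).restrictScalars ℝ
  exact conjHull_subset (s := ψ ⁻¹' {c}) ((convex_singleton c).linear_preimage ψ) h hy

theorem norm_le_of_mem_conjHull (hU : U ≤ unitary (H →L[ℂ] H)) (hx : x ∈ conjHull U z) :
    ‖x‖ ≤ ‖z‖ := by
  have hball : Convex ℝ (Metric.closedBall (0 : H →L[ℂ] H) ‖z‖) := convex_closedBall 0 ‖z‖
  refine mem_closedBall_zero_iff.1 (conjHull_subset hball (fun u hu => ?_) hx)
  rw [mem_closedBall_zero_iff, CStarRing.norm_mul_mem_unitary _ (Unitary.star_mem (hU hu)),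
    CStarRing.norm_mem_unitary_mul _ (hU hu)]

theorem IsIIOneStandardForm.norm_conj_apply (hM : IsIIOneStandardForm M Ω)
    (hu : u ∈ unitary (H →L[ℂ] H)) (huM : u ∈ M) (hx : x ∈ M) :
    ‖(u * x * star u) Ω‖ = ‖x Ω‖ := by
  have htrace : ⟪Ω, (u * (star x * x * star u)) Ω⟫_ℂ = ⟪Ω, (star x * x) Ω⟫_ℂ := by
    rw [hM.trace_comm _ huM _ (mul_mem (mul_mem (star_mem hx) hx) (star_mem huM)), mul_assoc,
      Unitary.star_mul_self_of_mem hu, mul_one]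
  have hstar : star (u * x * star u) * (u * x * star u) = u * (star x * x * star u) := by
    simp only [star_mul, star_star, mul_assoc]
    rw [← mul_assoc (star u) u, Unitary.star_mul_self_of_mem hu, one_mul]
  have hsq : ∀ y : H →L[ℂ] H, ‖y Ω‖ = √(RCLike.re ⟪Ω, (star y * y) Ω⟫_ℂ) := fun y => by
    rw [@norm_eq_sqrt_re_inner ℂ, mul_apply_eq_comp, inner_star]
  rw [hsq, hsq x, hstar, htrace]

theorem IsIIOneStandardForm.conj_apply_mem_closure (hM : IsIIOneStandardForm M Ω)
    (hU : U ≤ unitary (H →L[ℂ] H)) (hUM : ∀ u ∈ U, u ∈ M) (hz : z ∈ M) (hx : x ∈ M) (hu : u ∈ U)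
    (hxK : x Ω ∈ closure ((fun y : H →L[ℂ] H => y Ω) '' conjHull U z)) :
    (u * x * star u) Ω ∈ closure ((fun y : H →L[ℂ] H => y Ω) '' conjHull U z) := by
  rw [Metric.mem_closure_iff] at hxK ⊢
  intro ε hε
  obtain ⟨_, ⟨y, hy, rfl⟩, hdist⟩ := hxK ε hε
  refine ⟨_, ⟨u * y * star u, conj_mem_conjHull hu hy, rfl⟩, ?_⟩
  have hsub : (u * x * star u) Ω - (u * y * star u) Ω = (u * (x - y) * star u) Ω := by
    rw [mul_sub, sub_mul, sub_apply]
  rwa [dist_eq_norm, hsub, hM.norm_conj_apply (hU hu) (hUM u hu)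
    (sub_mem hx (conjHull_subset_vonNeumannAlgebra hUM hz hy)), sub_apply, ← dist_eq_norm]

theorem IsSeparatingVector.exists_mem_apply_eq_of_mem_closure_conjHull
    (hΩ : IsSeparatingVector M Ω) (hU : U ≤ unitary (H →L[ℂ] H)) (hUM : ∀ u ∈ U, u ∈ M)
    (hz : z ∈ M) {v : H} (hv : v ∈ closure ((fun y : H →L[ℂ] H => y Ω) '' conjHull U z)) :
    ∃ a ∈ M, a Ω = v := by
  refine hΩ.exists_mem_apply_eq (K := ‖z‖) fun t ht => ?_
  refine closure_minimal (t := {v | ‖t v‖ ≤ ‖z‖ * ‖t Ω‖}) ?_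
    (isClosed_le (by fun_prop) continuous_const) hv
  rintro _ ⟨y, hy, rfl⟩
  change ‖t (y Ω)‖ ≤ _
  rw [commutant_apply_comm (conjHull_subset_vonNeumannAlgebra hUM hz hy) ht]
  exact (y.le_opNorm _).trans (by gcongr; exact norm_le_of_mem_conjHull hU hy)

/-- The vector of minimal norm in the closed convex hull is fixed by all conjugations, because
these preserve the hull and its norm. -/
theorem IsIIOneStandardForm.exists_mem_closure_conjHull_commute (hM : IsIIOneStandardForm M Ω)
    (hU : U ≤ unitary (H →L[ℂ] H)) (hUM : ∀ u ∈ U, u ∈ M) (hz : z ∈ M) :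
    ∃ a ∈ M, a Ω ∈ closure ((fun y : H →L[ℂ] H => y Ω) '' conjHull U z) ∧
      ∀ u ∈ U, Commute u a := by
  let K := closure ((fun y : H →L[ℂ] H => y Ω) '' conjHull U z)
  have hconv : Convex ℝ K := ((convex_convexHull ℝ _).is_linear_image
    ((ContinuousLinearMap.apply ℂ H Ω).restrictScalars ℝ).isLinear).closure
  have hne : K.Nonempty :=
    ⟨z Ω, subset_closure ⟨z, subset_convexHull ℝ _ ⟨1, one_mem U, by simp⟩, rfl⟩⟩
  let : InnerProductSpace ℝ H := InnerProductSpace.complexToReal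
  obtain ⟨v, hvK, hmin⟩ := exists_mem_forall_norm_le_imp_eq hne isClosed_closure hconv
  obtain ⟨a, haM, rfl⟩ :=
    hM.isSeparatingVector.exists_mem_apply_eq_of_mem_closure_conjHull hU hUM hz hvK
  refine ⟨a, haM, hvK, fun u hu => ?_⟩
  have hfix : (u * a * star u) Ω = a Ω :=
    hmin _ (hM.conj_apply_mem_closure hU hUM hz haM hu hvK)
      (hM.norm_conj_apply (hU hu) (hUM u hu) haM).le
  have hconj : u * a * star u = a := sub_eq_zero.1 <| hM.isSeparatingVector _
    (sub_mem (mul_mem (mul_mem (hUM u hu) haM) (star_mem (hUM u hu))) haM)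
    (by rw [sub_apply, hfix, sub_self])
  calc u * a = u * a * (star u * u) := by rw [Unitary.star_mul_self_of_mem (hU hu), mul_one]
    _ = a * u := by rw [← mul_assoc, hconj]

theorem IsMasa.inner_conj_apply (hA : IsMasa A M) (hM : IsIIOneStandardForm M Ω)
    (hu : u ∈ unitary (H →L[ℂ] H)) (huA : u ∈ A) (hz : z ∈ M) {c : H →L[ℂ] H} (hc : c ∈ A) :
    ⟪c Ω, (u * z * star u) Ω⟫_ℂ = ⟪c Ω, z Ω⟫_ℂ := by
  have hcomm : star u * (star c * u) = star c := by
    rw [hA.comm _ (star_mem hc) _ huA, ← mul_assoc, Unitary.star_mul_self_of_mem hu, one_mul]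
  have htrace := hM.trace_comm (star c * u * z)
    (mul_mem (mul_mem (hA.le (star_mem hc)) (hA.le huA)) hz) (star u) (star_mem (hA.le huA))
  rw [← mul_assoc (star u), hcomm] at htrace
  rw [← inner_star, ← inner_star]
  simpa only [mul_assoc, mul_apply_eq_comp] using htrace

theorem IsMasaCoordinates.zero_mem_closure_conjHull {X : Type*} [TopologicalSpace X]
    [CompactSpace X] [MeasurableSpace X] {ι : C(X, ℂ) →⋆ₐ[ℂ] (H →L[ℂ] H)} {lam : Measure X}
    (hX : IsMasaCoordinates A Ω ι lam) (hM : IsIIOneStandardForm M Ω) (hA : IsMasa A M)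
    (hz : z ∈ M) (hz0 : ∀ c ∈ A, ⟪c Ω, z Ω⟫_ℂ = 0) :
    0 ∈ closure ((fun y : H →L[ℂ] H => y Ω) '' conjHull ((unitary C(X, ℂ)).map ι) z) := by
  have hU : (unitary C(X, ℂ)).map ι ≤ unitary (H →L[ℂ] H) := by
    rintro _ ⟨f, hf, rfl⟩
    exact Unitary.map_mem ι hf
  have hUA : ∀ u ∈ (unitary C(X, ℂ)).map ι, u ∈ A := by
    rintro _ ⟨f, -, rfl⟩
    exact hX.mem f
  have hUM := fun u hu => hA.le (hUA u hu)
  obtain ⟨a, haM, haK, hcomm⟩ := hM.exists_mem_closure_conjHull_commute hU hUM hz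
  have haA : a ∈ A := by
    refine hA.mem_of_mem_commutant haM (hX.mem_commutant_of_commute fun f => ?_)
    have hf : f ∈ Submodule.span ℂ (unitary C(X, ℂ) : Set C(X, ℂ)) := by
      rw [CStarAlgebra.span_unitary]
      trivial
    induction hf using Submodule.span_induction with
    | mem f hf => exact hcomm _ ⟨f, hf, rfl⟩
    | zero => rw [map_zero]; exact Commute.zero_left a
    | add f g _ _ hf hg => rw [map_add]; exact hf.add_left hg
    | smul c f _ hf => rw [map_smul]; exact hf.smul_left c
  have horth : ∀ c ∈ A, ⟪c Ω, a Ω⟫_ℂ = 0 := fun c hc =>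
    apply_eq_of_mem_closure_conjHull (φ := innerSL ℂ (c Ω))
      (fun u hu => (hA.inner_conj_apply hM (hU hu) (hUA u hu) hz hc).trans (hz0 c hc)) haK
  have ha0 : a Ω = 0 := eq_of_mem_masaL2 (apply_mem_masaL2 haA) (zero_mem _) fun c hc => by
    rw [horth c hc, inner_zero_right]
  exact ha0 ▸ haK

end Conjugates

theorem inner_toLp_indicator {Y E : Type*} [MeasurableSpace Y] {μ : Measure Y}
    [NormedAddCommGroup E] [InnerProductSpace ℂ E] {s : Set Y} (hs : MeasurableSet s)
    (F G : Lp E 2 μ) :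
    ⟪((Lp.memLp F).indicator hs).toLp, G⟫_ℂ = ∫ p in s, ⟪F p, G p⟫_ℂ ∂μ := by
  rw [L2.inner_def, ← integral_indicator hs]
  refine integral_congr_ae ?_
  filter_upwards [((Lp.memLp F).indicator hs).coeFn_toLp] with p hp
  rw [hp]
  by_cases h : p ∈ s <;> simp [h]

section Bimodule
variable {H : Type*} [NormedAddCommGroup H] [InnerProductSpace ℂ H] [CompleteSpace H]
  {A M : VonNeumannAlgebra H} {Ω : H}
  {X : Type*} [TopologicalSpace X] [MeasurableSpace X]
  {ι : C(X, ℂ) →⋆ₐ[ℂ] (H →L[ℂ] H)} {lam : Measure X} {η : Measure (X × X)}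
  {E : Type*} [NormedAddCommGroup E] [InnerProductSpace ℂ E] {V : H →ₗᵢ[ℂ] Lp E 2 η}
  {x : H →L[ℂ] H}

/-- `V` is a spectral representation of `L²(M)` as a `C(X)`-bimodule: it turns the left action of
`f` and the right action of `g` into multiplication by `f(t) g(s)`. -/
def IntertwinesBimodule (M : VonNeumannAlgebra H) (Ω : H) (ι : C(X, ℂ) →⋆ₐ[ℂ] (H →L[ℂ] H))
    (V : H →ₗᵢ[ℂ] Lp E 2 η) : Prop :=
  ∀ x ∈ M, ∀ f g : C(X, ℂ),
    ∀ᵐ p ∂η, V ((ι f * x * ι g) Ω) p = (f p.1 * g p.2) • V (x Ω) p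

theorem IntertwinesBimodule.inner_eq_integral (hV : IntertwinesBimodule M Ω ι V) (hx : x ∈ M)
    (w : H) (f g : C(X, ℂ)) :
    ⟪w, (ι f * x * ι g) Ω⟫_ℂ = ∫ p, f p.1 * g p.2 * ⟪V w p, V (x Ω) p⟫_ℂ ∂η := by
  rw [← V.inner_map_map, L2.inner_def]
  refine integral_congr_ae ?_
  filter_upwards [hV x hx f g] with p hp
  rw [hp, inner_smul_right]

theorem IsMeasureMultiplicity.exists_intertwinesBimodule {m : X × X → ℕ∞}
    (hη : IsMeasureMultiplicity M Ω ι η m) :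
    ∃ V : H →ₗᵢ[ℂ] Lp (lp (fun _ : ℕ => ℂ) 2) 2 η, IntertwinesBimodule M Ω ι V := by
  obtain ⟨-, -, -, W, hW⟩ := hη
  exact ⟨(directIntegral η m).subtypeₗᵢ.comp W.toLinearIsometry, hW⟩

/-- `k` is the density with respect to `ν` of the bimodule coefficient
`(f, g) ↦ ⟪w, (f x g) Ω⟫`, regarded as a complex measure on `X × X`. -/
structure IsBimoduleDensity (Ω : H) (ι : C(X, ℂ) →⋆ₐ[ℂ] (H →L[ℂ] H)) (ν : Measure (X × X))
    (w : H) (x : H →L[ℂ] H) (k : X × X → ℂ) : Prop where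
  integrable : Integrable k ν
  inner_eq_integral : ∀ f g : C(X, ℂ), ⟪w, (ι f * x * ι g) Ω⟫_ℂ = ∫ p, f p.1 * g p.2 * k p ∂ν

variable [CompactSpace X] [MeasurableEq X]

theorem IntertwinesBimodule.ae_eq_zero_of_mem_diagonal (hV : IntertwinesBimodule M Ω ι V)
    (hM : IsIIOneStandardForm M Ω) (hA : IsMasa A M)
    (hX : IsMasaCoordinates A Ω ι lam) (hx : x ∈ M) (hx0 : ∀ c ∈ A, ⟪c Ω, x Ω⟫_ℂ = 0) :
    ∀ᵐ p ∂η, p ∈ Set.diagonal X → V (x Ω) p = 0 := by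
  have hΔ : MeasurableSet (Set.diagonal X) := MeasurableEq.measurableSet_diagonal
  let G : Lp E 2 η := ((Lp.memLp (V (x Ω))).indicator hΔ).toLp
  have hG : G =ᵐ[η] (Set.diagonal X).indicator (V (x Ω)) := MemLp.coeFn_toLp _
  have hconst : ∀ u ∈ (unitary C(X, ℂ)).map ι,
      ⟪G, V ((u * x * star u) Ω)⟫_ℂ = ⟪G, V (x Ω)⟫_ℂ := by
    rintro _ ⟨f, hf, rfl⟩
    rw [← map_star, inner_toLp_indicator hΔ, inner_toLp_indicator hΔ]
    refine setIntegral_congr_ae hΔ ?_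
    filter_upwards [hV x hx f (star f)] with p hp hdiag
    have hunit : f p.1 * star f p.2 = 1 := by
      rw [← Set.mem_diagonal_iff.1 hdiag]
      exact congrArg (fun g : C(X, ℂ) => g p.1) (Unitary.mul_star_self_of_mem hf)
    rw [hp, hunit, one_smul]
  have hGx : ⟪G, V (x Ω)⟫_ℂ = 0 := by
    have := apply_eq_of_mem_closure_conjHull (φ := (innerSL ℂ G).comp V.toContinuousLinearMap)
      hconst (hX.zero_mem_closure_conjHull hM hA hx hx0)
    rw [← this, map_zero]
  have hGG : ⟪G, G⟫_ℂ = ⟪G, V (x Ω)⟫_ℂ := by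
    rw [inner_toLp_indicator hΔ, inner_toLp_indicator hΔ]
    refine setIntegral_congr_ae hΔ (hG.mono fun p hp hdiag => ?_)
    rw [hp, Set.indicator_of_mem hdiag]
  have hG0 : G =ᵐ[η] 0 := (Lp.eq_zero_iff_ae_eq_zero).1 (inner_self_eq_zero.1 (hGG.trans hGx))
  filter_upwards [hG, hG0] with p hp hp0 hdiag
  rw [← Set.indicator_of_mem hdiag (V (x Ω)), ← hp, hp0, Pi.zero_apply]

theorem IntertwinesBimodule.exists_isBimoduleDensity (hV : IntertwinesBimodule M Ω ι V)
    (hM : IsIIOneStandardForm M Ω) (hA : IsMasa A M)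
    (hX : IsMasaCoordinates A Ω ι lam) {ν : Measure (X × X)} [SigmaFinite ν] [SigmaFinite η]
    (hac : η.restrict (Set.diagonal X)ᶜ ≪ ν) (hx : x ∈ M) (hx0 : ∀ c ∈ A, ⟪c Ω, x Ω⟫_ℂ = 0)
    (w : H) :
    ∃ k : X × X → ℂ, IsBimoduleDensity Ω ι ν w x k := by
  let B : X × X → ℂ := fun p => ⟪V w p, V (x Ω) p⟫_ℂ
  have hB : Integrable B η := L2.integrable_inner _ _
  have hB0 : ∀ᵐ p ∂η, p ∈ Set.diagonal X → B p = 0 :=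
    (hV.ae_eq_zero_of_mem_diagonal hM hA hX hx hx0).mono fun p hp hdiag => by
      simp only [B, hp hdiag, inner_zero_right]
  refine ⟨fun p => ((η.restrict (Set.diagonal X)ᶜ).rnDeriv ν p).toReal • B p,
    (integrable_rnDeriv_smul_iff hac).2 hB.restrict, fun f g => ?_⟩
  calc ⟪w, (ι f * x * ι g) Ω⟫_ℂ = ∫ p, f p.1 * g p.2 * B p ∂η := hV.inner_eq_integral hx w f g
    _ = ∫ p in (Set.diagonal X)ᶜ, f p.1 * g p.2 * B p ∂η := by
      refine (setIntegral_eq_integral_of_ae_compl_eq_zero (hB0.mono fun p hp hdiag => ?_)).symm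
      rw [hp (not_not.1 hdiag), mul_zero]
    _ = _ := by
      rw [← integral_rnDeriv_smul hac]
      exact integral_congr_ae (ae_of_all _ fun p => (mul_smul_comm _ _ _).symm)

end Bimodule

theorem integral_mul_integral_swap {X Y : Type*} [MeasurableSpace X] [MeasurableSpace Y]
    {μ : Measure X} {ν : Measure Y} [SFinite μ] [SFinite ν] {k : X × Y → ℂ}
    (hk : Integrable k (μ.prod ν)) {φ : X → ℂ} {ψ : Y → ℂ} {C D : ℝ}
    (hφm : AEStronglyMeasurable φ μ) (hφ : ∀ᵐ t ∂μ, ‖φ t‖ ≤ C)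
    (hψm : AEStronglyMeasurable ψ ν) (hψ : ∀ᵐ s ∂ν, ‖ψ s‖ ≤ D) :
    ∫ t, φ t * ∫ s, k (t, s) * ψ s ∂ν ∂μ = ∫ s, (∫ t, φ t * k (t, s) ∂μ) * ψ s ∂ν := by
  have hint : Integrable (fun p : X × Y => φ p.1 * (k p * ψ p.2)) (μ.prod ν) :=
    (hk.mul_bdd hψm.comp_snd (Measure.quasiMeasurePreserving_snd.ae hψ)).bdd_mul hφm.comp_fst
      (Measure.quasiMeasurePreserving_fst.ae hφ)
  calc ∫ t, φ t * ∫ s, k (t, s) * ψ s ∂ν ∂μ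
      = ∫ t, ∫ s, φ t * (k (t, s) * ψ s) ∂ν ∂μ := by simp only [integral_const_mul]
    _ = ∫ s, ∫ t, φ t * (k (t, s) * ψ s) ∂μ ∂ν := integral_integral_swap hint
    _ = ∫ s, (∫ t, φ t * k (t, s) ∂μ) * ψ s ∂ν := by
      simp only [← mul_assoc, integral_mul_const]

section ConditionalExpectation
variable {H : Type*} [NormedAddCommGroup H] [InnerProductSpace ℂ H] [CompleteSpace H]
  {A M : VonNeumannAlgebra H} {Ω : H} {x y : H →L[ℂ] H}

theorem inner_apply_eq_zero_of_masaCondExp_eq_zero (hM : IsIIOneStandardForm M Ω)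
    (hA : IsMasa A M) (hx : x ∈ M) (hx0 : masaCondExp hM hA x hx = 0)
    {c : H →L[ℂ] H} (hc : c ∈ A) : ⟪c Ω, x Ω⟫_ℂ = 0 := by
  rw [← jonesProj_of_mem (apply_mem_masaL2 hc), jonesProj_inner, ← masaCondExp_apply hM hA hx, hx0,
    zero_apply, inner_zero_right]

theorem IsIIOneStandardForm.inner_mul_mul_star (hM : IsIIOneStandardForm M Ω) (hx : x ∈ M)
    {u : H →L[ℂ] H} (hu : u ∈ M) (hy : y ∈ M) :
    ⟪Ω, (x * u * star y) Ω⟫_ℂ = ⟪star x (y Ω), u Ω⟫_ℂ := by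
  rw [hM.trace_comm _ (mul_mem hx hu) _ (star_mem hy), mul_apply_eq_comp, inner_star,
    mul_apply_eq_comp, inner_star']

variable {X : Type*} [TopologicalSpace X] [CompactSpace X] [T2Space X] [SecondCountableTopology X]
  [MeasurableSpace X] [BorelSpace X]
  {ι : C(X, ℂ) →⋆ₐ[ℂ] (H →L[ℂ] H)} {lam : Measure X} [IsFiniteMeasure lam] {k : X × X → ℂ}
  {w : H}

namespace IsMasaCoordinates

theorem toL2_masaCondExp (hX : IsMasaCoordinates A Ω ι lam) (hM : IsIIOneStandardForm M Ω)
    (hA : IsMasa A M) {z : H →L[ℂ] H} (hz : z ∈ M) :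
    hX.toL2 (masaCondExp hM hA z hz Ω) = hX.toL2 (z Ω) := by
  rw [masaCondExp_apply]
  refine congrArg hX.equivMasaL2.symm ?_
  exact Submodule.orthogonalProjectionOnto_mem_subspace_eq_self
    ((masaL2 A Ω).orthogonalProjectionOnto (z Ω))

theorem star_toL2_ae_eq_integral (hX : IsMasaCoordinates A Ω ι lam)
    (hk : IsBimoduleDensity Ω ι (lam.prod lam) w x k) (f : C(X, ℂ)) :
    (fun s => star (hX.toL2 (star (ι f * x) w) s)) =ᵐ[lam]
      fun s => ∫ t, f t * k (t, s) ∂lam := by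
  have hfk : Integrable (fun p : X × X => f p.1 * k p) (lam.prod lam) :=
    hk.integrable.bdd_mul (f.continuous.comp continuous_fst).aestronglyMeasurable
      (ae_of_all _ fun p => f.norm_coe_le_norm p.1)
  have hgk (g : C(X, ℂ)) : Integrable (fun p : X × X => g p.2 * (f p.1 * k p)) (lam.prod lam) :=
    hfk.bdd_mul (g.continuous.comp continuous_snd).aestronglyMeasurable
      (ae_of_all _ fun p => g.norm_coe_le_norm p.2)
  refine ae_eq_of_forall_integral_continuousMap_mul
    ((Complex.conjCLE : ℂ →L[ℝ] ℂ).integrable_comp (hX.integrable_toL2 _))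
    hfk.integral_prod_right fun g => ?_
  calc ∫ s, g s * star (hX.toL2 (star (ι f * x) w) s) ∂lam
      = star ⟪ι g Ω, star (ι f * x) w⟫_ℂ := by
        rw [hX.inner_map_eq_integral, ← starRingEnd_apply, ← integral_conj]
        simp
    _ = ⟪w, (ι f * x * ι g) Ω⟫_ℂ := by
        rw [inner_star]
        exact inner_conj_symm _ _
    _ = ∫ p, g p.2 * (f p.1 * k p) ∂lam.prod lam := by
        rw [hk.inner_eq_integral]
        simp only [mul_assoc, mul_left_comm (g _)]
    _ = ∫ s, g s * ∫ t, f t * k (t, s) ∂lam ∂lam := by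
        simp only [integral_prod_symm _ (hgk g), integral_const_mul]

theorem toL2_mul_mul_star_ae_eq (hX : IsMasaCoordinates A Ω ι lam) (hM : IsIIOneStandardForm M Ω)
    (hA : IsMasa A M) (hx : x ∈ M) (hy : y ∈ M)
    (hk : IsBimoduleDensity Ω ι (lam.prod lam) (y Ω) x k) {u : H →L[ℂ] H} (hu : u ∈ A) :
    hX.toL2 ((x * u * star y) Ω) =ᵐ[lam] fun t => ∫ s, k (t, s) * hX.toL2 (u Ω) s ∂lam := by
  have hψm := Lp.aestronglyMeasurable (hX.toL2 (u Ω))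
  have hψ := hX.norm_toL2_apply_le hA hu
  have hkψ : Integrable (fun p : X × X => k p * hX.toL2 (u Ω) p.2) (lam.prod lam) :=
    hk.integrable.mul_bdd hψm.comp_snd (Measure.quasiMeasurePreserving_snd.ae hψ)
  refine ae_eq_of_forall_integral_continuousMap_mul (hX.integrable_toL2 _)
    hkψ.integral_prod_left fun f => ?_
  calc ∫ t, f t * hX.toL2 ((x * u * star y) Ω) t ∂lam
      = ⟪Ω, (ι f * x * u * star y) Ω⟫_ℂ := by
        rw [← hX.inner_map_star_eq_integral, inner_map_star, ← mul_apply_eq_comp]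
        simp only [mul_assoc]
    _ = ⟪star (ι f * x) (y Ω), u Ω⟫_ℂ :=
        hM.inner_mul_mul_star (mul_mem (hA.le (hX.mem f)) hx) (hA.le hu) hy
    _ = ∫ s, star (hX.toL2 (star (ι f * x) (y Ω)) s) * hX.toL2 (u Ω) s ∂lam :=
        hX.inner_apply_eq_integral hu _
    _ = ∫ s, (∫ t, f t * k (t, s) ∂lam) * hX.toL2 (u Ω) s ∂lam :=
        integral_congr_ae ((hX.star_toL2_ae_eq_integral hk f).mono fun s hs => by
          simp only [hs])
    _ = ∫ t, f t * ∫ s, k (t, s) * hX.toL2 (u Ω) s ∂lam ∂lam :=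
        (integral_mul_integral_swap hk.integrable f.continuous.aestronglyMeasurable
          (ae_of_all _ f.norm_coe_le_norm) hψm hψ).symm

end IsMasaCoordinates

theorem theorem4p3_general (hM : IsIIOneStandardForm M Ω) (hA : IsMasa A M)
    (hX : IsMasaCoordinates A Ω ι lam) {η : Measure (X × X)} {m : X × X → ℕ∞}
    (hη : IsMeasureMultiplicity M Ω ι η m) (hac : η.restrict (Set.diagonal X)ᶜ ≪ lam.prod lam)
    (hx : x ∈ M) (hy : y ∈ M) (hx0 : masaCondExp hM hA x hx = 0)
    {u : ℕ → H →L[ℂ] H} (hu : ∀ n, u n ∈ A) (hbdd : ∃ C : ℝ, ∀ n, ‖u n‖ ≤ C)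
    (hnull : Tendsto (fun n => ContinuousLinearMapWOT.ofCLM (u n)) atTop
      (𝓝 (0 : H →WOT[ℂ] H))) :
    (∀ n, ∃ φ : X → ℂ, IsFunctionOf Ω ι lam (masaCondExp hM hA (x * u n * star y)
      (mul_mem (mul_mem hx (hA.le (hu n))) (star_mem hy))) φ) ∧
    ∀ φ : ℕ → X → ℂ, (∀ n, IsFunctionOf Ω ι lam (masaCondExp hM hA (x * u n * star y)
      (mul_mem (mul_mem hx (hA.le (hu n))) (star_mem hy))) (φ n)) →
      ∀ᵐ t ∂lam, Tendsto (fun n => φ n t) atTop (𝓝 0) := by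
  have hfun (n : ℕ) := hX.isFunctionOf_toL2 hA
    (masaCondExp_mem hM hA (mul_mem (mul_mem hx (hA.le (hu n))) (star_mem hy)))
  simp only [hX.toL2_masaCondExp hM hA] at hfun
  refine ⟨fun n => ⟨_, hfun n⟩, fun φ hφ => ?_⟩
  have := hη.1
  obtain ⟨V, hV⟩ := hη.exists_intertwinesBimodule
  obtain ⟨k, hk⟩ := hV.exists_isBimoduleDensity hM hA hX hac hx
    (fun c => inner_apply_eq_zero_of_masaCondExp_eq_zero hM hA hx hx0) (y Ω)
  obtain ⟨C, hC⟩ := hbdd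
  have hφk : ∀ᵐ t ∂lam, ∀ n, φ n t = ∫ s, k (t, s) * hX.toL2 (u n Ω) s ∂lam :=
    ae_all_iff.2 fun n => ((hφ n).ae_eq (hfun n)).trans
      (hX.toL2_mul_mul_star_ae_eq hM hA hx hy hk (hu n))
  filter_upwards [hφk, hk.integrable.prod_right_ae] with t hφt hkt
  simp only [hφt]
  exact tendsto_integral_mul_of_forall_boundedContinuous (fun n => Lp.aestronglyMeasurable _)
    (fun n => (hX.norm_toL2_apply_le hA (hu n)).mono fun s hs => hs.trans (hC n))
    (fun f _ => hX.tendsto_integral_mul_toL2 hnull f.toContinuousMap) hkt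

end ConditionalExpectation

theorem theorem4p3 {H : Type*} [NormedAddCommGroup H] [InnerProductSpace ℂ H] [CompleteSpace H]
    [TopologicalSpace.SeparableSpace H] {M A : VonNeumannAlgebra H} {Ω : H}
    (hM : IsIIOneStandardForm M Ω) (hA : IsMasa A M)
    {X : Type*} [TopologicalSpace X] [CompactSpace X] [T2Space X] [SecondCountableTopology X]
    [MeasurableSpace X] [BorelSpace X]
    (ι : C(X, ℂ) →⋆ₐ[ℂ] (H →L[ℂ] H)) (lam : Measure X) [IsProbabilityMeasure lam]
    (hX : IsMasaCoordinates A Ω ι lam) (hprod : IsProductClass M Ω ι lam)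
    (x y : H →L[ℂ] H) (hx : x ∈ M) (hy : y ∈ M)
    (hx0 : masaCondExp hM hA x hx = 0) (hy0 : masaCondExp hM hA y hy = 0)
    (u : ℕ → H →L[ℂ] H) (hu : ∀ n, u n ∈ A) (hbdd : ∃ C : ℝ, ∀ n, ‖u n‖ ≤ C)
    (hnull : Tendsto (fun n => ContinuousLinearMapWOT.ofCLM (u n)) atTop
      (𝓝 (0 : H →WOT[ℂ] H))) :
    (∀ n, ∃ φ : X → ℂ, IsFunctionOf Ω ι lam (masaCondExp hM hA (x * u n * star y)
      (mul_mem (mul_mem hx (hA.le (hu n))) (star_mem hy))) φ) ∧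
    ∀ φ : ℕ → X → ℂ, (∀ n, IsFunctionOf Ω ι lam (masaCondExp hM hA (x * u n * star y)
      (mul_mem (mul_mem hx (hA.le (hu n))) (star_mem hy))) (φ n)) →
      ∀ᵐ t ∂lam, Tendsto (fun n => φ n t) atTop (𝓝 0) := by
  obtain ⟨η, m, hη, hac, -⟩ := hprod
  exact theorem4p3_general hM hA hX hη hac hx hy hx0 hu hbdd hnull
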